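/- Let $N\ge 0$ and $d\ge 0$ be integers, and write $A'$ for the transpose of $A$. A sequence $[x_k]=(x_0,\dots,x_N)$ of random vectors in $\mathbb R^d$ is called zero-mean nonsingular Gaussian (ZMNG) if $x_0,\dots,x_N$ are jointly Gaussian with zero means and the covariance matrix of the stacked vector $(x_0',\dots,x_N')'$ is nonsingular. It is white if, in addition, $\mathrm{Cov}(x_i,x_j)=0$ for $i\ne j$. It is reciprocal if for all times $0\le j<l\le N$, conditionally on $(x_j,x_l)$, the segment $(x_i)_{j<i<l}$ is independent of $(x_i)_{i<j\text{ or }i>l}$. A $CM_L$ model of $[x_k]$, with parameters $(G_{k,k-1},G_{k,N},G_k)$, $k\in[1,N-1]$, and boundary parameters $(G_{0,N},G_0,G_N)$ (all $d\times d$ matrices), is a representation $$x_k=G_{k,k-1}x_{k-1}+G_{k,N}x_N+e_k,\quad k\in[1,N-1],\qquad x_N=e_N,\quad x_0=G_{0,N}x_N+e_0$$ (almost surely), where $[e_k]$ is a white ZMNG sequence with $\mathrm{Cov}(e_k)=G_k$, $k\in[0,N]$. A Markov model $y_k=M_{k,k-1}y_{k-1}+e_k$, $k\in[1,N]$, where $y_0=e_0$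 and $[e_k]$ is a white ZMNG sequence with $\mathrm{Cov}(e_k)=M_k$, has as parameters $d\times d$ matrices $M_{k,k-1}$ and positive definite $d\times d$ matrices $M_k$, $k\in[1,N]$. Put $M_{N|N}=I$, $M_{N|k}=M_{N,N-1}\cdots M_{k+1,k}$ for $k<N$, and $C_{N|k}=\sum_{n=k}^{N-1}M_{N|n+1}M_{n+1}M_{N|n+1}'$. A $CM_L$ model is said to be induced by this Markov model if, for all $k\in[1,N-1]$, $$G_{k,k-1}=M_{k,k-1}-G_{k,N}M_{N|k}M_{k,k-1},\qquad G_{k,N}=G_kM_{N|k}'C_{N|k}^{-1},\qquad G_k=\bigl(M_k^{-1}+M_{N|k}'C_{N|k}^{-1}M_{N|k}\bigr)^{-1}$$ (the boundary parameters are not constrained). Theorem (Markov-induced $CM_L$ model). Let $[x_k]$ be a ZMNG sequence. (i) $[x_k]$ is reciprocal if and only if it has a $CM_L$ model that is induced by some Markov model. (ii) For every $CM_L$ model of $[x_k]$, the sequence $[x_k]$ is reciprocal if and only if that $CM_L$ model is induced by some Markov model. In particular, every $CM_L$ model of a reciprocal ZMNG sequence is induced by a Markov model. -/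

import Mathlib

open MeasureTheory ProbabilityTheory Matrix

/-! Sequences over the time interval `[0,N]` are written `x : ℕ → Ω → (Fin d → ℝ)`; every definition
below that takes the horizon `N` looks only at the values `x k` with `k ≤ N`. Likewise, a family of
parameter matrices is a function of the time `k`, used only in the stated range of `k`. -/

noncomputable section

namespace CMSeq

variable {Ω : Type*} {d : ℕ}

/-- The cross-covariance matrix of two `ℝ^d`-valued random vectors. -/
def crossCov [MeasurableSpace Ω] (μ : Measure Ω) (X Y : Ω → (Fin d → ℝ)) : Matrix (Fin d) (Fin d) ℝ :=
  Matrix.of fun a b => cov[fun ω => X ω a, fun ω => Y ω b; μ]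

/-- The covariance matrix `C` of the stacked vector `(x_0, x_1, …, x_N)`. -/
def covMatrix [MeasurableSpace Ω] (N : ℕ) (μ : Measure Ω) (x : ℕ → Ω → (Fin d → ℝ)) :
    Matrix (Fin (N + 1) × Fin d) (Fin (N + 1) × Fin d) ℝ :=
  Matrix.of fun p q => crossCov μ (x p.1) (x q.1) p.2 q.2

/-- `[x_k]`, `k ∈ [0,N]`, is a zero-mean nonsingular Gaussian (ZMNG) sequence: the `x_k` are random
vectors that are jointly Gaussian, with zero mean and a nonsingular covariance matrix. -/
structure IsZMNG [MeasurableSpace Ω] (N : ℕ) (μ : Measure Ω) (x : ℕ → Ω → (Fin d → ℝ)) : Prop where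
  measurable : ∀ k ≤ N, Measurable (x k)
  gaussian : HasGaussianLaw (fun ω => fun k : Fin (N + 1) => x k ω) μ
  zero_mean : ∀ k ≤ N, ∫ ω, x k ω ∂μ = 0
  nonsingular : (covMatrix N μ x).PosDef

/-- `[e_k]`, `k ∈ [0,N]`, is a zero-mean white nonsingular Gaussian sequence: ZMNG, and the values at
distinct times are uncorrelated. -/
structure IsWhiteZMNG [MeasurableSpace Ω] (N : ℕ) (μ : Measure Ω) (e : ℕ → Ω → (Fin d → ℝ)) : Prop where
  zmng : IsZMNG N μ e
  white : ∀ i ≤ N, ∀ j ≤ N, i ≠ j → crossCov μ (e i) (e j) = 0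

/-- The σ-algebra generated by the states `x_i`, `i ∈ S`. -/
@[reducible]
def sigmaOf (x : ℕ → Ω → (Fin d → ℝ)) (S : Set ℕ) : MeasurableSpace Ω :=
  ⨆ i ∈ S, MeasurableSpace.comap (x i) inferInstance

/-- Conditional independence of the σ-algebras `m₁` and `m₂` given `m'`, on an arbitrary probability
space. On standard Borel spaces it is Mathlib's `CondIndep`, see `condIndepGiven_iff_condIndep`. -/
def CondIndepGiven {Ω : Type*} (m' m₁ m₂ : MeasurableSpace Ω) {mΩ : MeasurableSpace Ω}
    (μ : Measure Ω) : Prop :=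
  ∀ s t : Set Ω, MeasurableSet[m₁] s → MeasurableSet[m₂] t →
    (μ⟦s ∩ t | m'⟧) =ᵐ[μ] (μ⟦s | m'⟧) * (μ⟦t | m'⟧)

theorem condIndepGiven_iff_condIndep {Ω : Type*} (m' m₁ m₂ : MeasurableSpace Ω)
    {mΩ : MeasurableSpace Ω} [StandardBorelSpace Ω] (hm' : m' ≤ mΩ) (hm₁ : m₁ ≤ mΩ)
    (hm₂ : m₂ ≤ mΩ) (μ : Measure Ω) [IsFiniteMeasure μ] :
    CondIndepGiven m' m₁ m₂ μ ↔ CondIndep m' m₁ m₂ hm' μ :=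
  (condIndep_iff m' m₁ m₂ hm' hm₁ hm₂ μ).symm

/-- `[x_k]`, `k ∈ [0,N]`, is reciprocal: for any two times `j < l`, given `x_j` and `x_l` the segment
inside `(j,l)` is independent of the two segments outside `[j,l]`. -/
def IsReciprocal [MeasurableSpace Ω] (N : ℕ) (μ : Measure Ω) (x : ℕ → Ω → (Fin d → ℝ)) : Prop :=
  ∀ j l : ℕ, j < l → l ≤ N →
    CondIndepGiven (sigmaOf x {j, l}) (sigmaOf x {i | j < i ∧ i < l})
      (sigmaOf x {i | i ≤ N ∧ (i < j ∨ l < i)}) μ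

/-- Parameters of a `CM_L` model over `[0,N]` with its boundary condition: `Gprev k = G_{k,k-1}` for
`k ∈ [1,N-1]`, `Gend k = G_{k,N}` for `k ∈ [0,N-1]`, `Gcov k = G_k` for `k ∈ [0,N]`. -/
structure CMLParams (d : ℕ) where
  Gprev : ℕ → Matrix (Fin d) (Fin d) ℝ
  Gend : ℕ → Matrix (Fin d) (Fin d) ℝ
  Gcov : ℕ → Matrix (Fin d) (Fin d) ℝ

/-- `[x_k]` obeys the `CM_L` model with parameters `G`: there is a zero-mean white nonsingular
Gaussian sequence `[e_k]` with `Cov(e_k) = G_k`, `k ∈ [0,N]`, such that (almost surely)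
`x_k = G_{k,k-1} x_{k-1} + G_{k,N} x_N + e_k` for `k ∈ [1,N-1]`, and
`x_N = e_N`, `x_0 = G_{0,N} x_N + e_0`. -/
def CMLParams.IsModelOf [MeasurableSpace Ω] (N : ℕ) (μ : Measure Ω) (G : CMLParams d)
    (x : ℕ → Ω → (Fin d → ℝ)) : Prop :=
  ∃ e : ℕ → Ω → (Fin d → ℝ), IsWhiteZMNG N μ e ∧
    (∀ k ≤ N, crossCov μ (e k) (e k) = G.Gcov k) ∧
    (∀ k, 1 ≤ k → k < N → ∀ᵐ ω ∂μ,
      x k ω = G.Gprev k *ᵥ x (k - 1) ω + G.Gend k *ᵥ x N ω + e k ω) ∧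
    (∀ᵐ ω ∂μ, x N ω = e N ω) ∧
    (∀ᵐ ω ∂μ, x 0 ω = G.Gend 0 *ᵥ x N ω + e 0 ω)

/-- Parameters of a Markov model `y_k = M_{k,k-1} y_{k-1} + e_k`, `k ∈ [1,N]`, where `[e_k]` is white
with `Cov(e_k) = M_k`: square matrices `M_{k,k-1} = Mprev k` and positive definite matrices
`M_k = Mcov k`, `k ∈ [1,N]`. -/
structure MarkovParams (N d : ℕ) where
  Mprev : ℕ → Matrix (Fin d) (Fin d) ℝ
  Mcov : ℕ → Matrix (Fin d) (Fin d) ℝ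
  posDef : ∀ k, 1 ≤ k → k ≤ N → (Mcov k).PosDef

namespace MarkovParams

variable {N : ℕ} (M : MarkovParams N d)

/-- `transFrom k m` is the `m`-step transition matrix `M_{k+m,k+m-1} ⋯ M_{k+1,k}` from time `k`. -/
def transFrom (k : ℕ) : ℕ → Matrix (Fin d) (Fin d) ℝ
  | 0 => 1
  | m + 1 => M.Mprev (k + m + 1) * transFrom k m

/-- `M_{N|k} = M_{N,N-1} ⋯ M_{k+1,k}` for `k < N`, and `M_{N|N} = I`. -/
def trans (k : ℕ) : Matrix (Fin d) (Fin d) ℝ := M.transFrom k (N - k)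

/-- `C_{N|k} = ∑_{n=k}^{N-1} M_{N|n+1} M_{n+1} M_{N|n+1}'`. -/
def condCov (k : ℕ) : Matrix (Fin d) (Fin d) ℝ :=
  ∑ n ∈ Finset.Ico k N, M.trans (n + 1) * M.Mcov (n + 1) * (M.trans (n + 1))ᵀ

end MarkovParams

/-- The `CM_L` model with parameters `(G_{k,k-1}, G_{k,N}, G_k)`, `k ∈ [1,N-1]`, is induced by the
Markov model with parameters `(M_{k,k-1}, M_k)`, `k ∈ [1,N]`. (The parameters `G_{0,N}`, `G_0`, `G_N`
of the boundary condition are not constrained.) -/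
def CMLParams.IsInducedBy {N : ℕ} (G : CMLParams d) (M : MarkovParams N d) : Prop :=
  ∀ k, 1 ≤ k → k < N →
    G.Gprev k = M.Mprev k - G.Gend k * M.trans k * M.Mprev k ∧
    G.Gend k = G.Gcov k * (M.trans k)ᵀ * (M.condCov k)⁻¹ ∧
    G.Gcov k = ((M.Mcov k)⁻¹ + (M.trans k)ᵀ * (M.condCov k)⁻¹ * M.trans k)⁻¹

end CMSeq

end

/-! Both reciprocity and being induced by a Markov model amount, for a given `CM_L` model, to one
backward recursion: G_k⁻¹ G_{k,N} = G_{k+1,k}' G_{k+1}⁻¹ G_{k+1,N} for 1 ≤ k ≤ N-2.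

Reciprocity: in a nonsingular Gaussian vector, two blocks are conditionally independent given the
rest iff their block of the inverse covariance C⁻¹ vanishes
(`IsCentredGaussian.condIndepGiven_iff`). Hence reciprocity says that the block rows 1, …, N-1 of
C⁻¹ are tridiagonal (`IsZMNG.isReciprocal_iff`). A model reads e = T x, so C⁻¹ = T' D⁻¹ T with D =
diag(G_k). In those rows and off the three diagonals only column N can be nonzero, and its entries
are the defects of the recursion (`IsModelOf.isReciprocal_iff`).

Markov models: if the model is induced, then G_k⁻¹ G_{k,N} = M_{N|k}' C_{N|k}⁻¹, and the recursion
is an algebraic identity (`IsInducedBy.recursion`). Conversely, put B_k = G_k⁻¹ G_{k,N} and Q_k =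
Q_{k-1} + B_k' G_k B_k with Q_0 = I. Prescribing C_{N|k} = Q_k⁻¹ and M_{N|k} = Q_k⁻¹ B_k' determines
a Markov model, and the recursion makes it consistent (`isInducedBy_toMarkov`).

Existence: regressing x_k on x_{k-1} and x_N leaves residuals which reciprocity makes white
(`exists_isModelOf`). -/

noncomputable section

namespace CMSeq

/-! ### Conditional independence of σ-algebras on an arbitrary probability space -/

section CondIndep

variable {Ω : Type*} {mΩ : MeasurableSpace Ω} {μ : Measure Ω}

theorem sup_eq_generateFrom_inter (m₁ m₂ : MeasurableSpace Ω) :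
    m₁ ⊔ m₂ = MeasurableSpace.generateFrom
      {s | ∃ a c, MeasurableSet[m₁] a ∧ MeasurableSet[m₂] c ∧ a ∩ c = s} := by
  refine le_antisymm (sup_le (fun a ha => ?_) fun c hc => ?_)
    (MeasurableSpace.generateFrom_le ?_)
  · exact MeasurableSpace.measurableSet_generateFrom
      ⟨a, Set.univ, ha, MeasurableSet.univ, Set.inter_univ a⟩
  · exact MeasurableSpace.measurableSet_generateFrom
      ⟨Set.univ, c, MeasurableSet.univ, hc, Set.univ_inter c⟩
  · rintro _ ⟨a, c, ha, hc, rfl⟩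
    exact MeasurableSet.inter ((le_sup_left : m₁ ≤ m₁ ⊔ m₂) a ha)
      ((le_sup_right : m₂ ≤ m₁ ⊔ m₂) c hc)

theorem isPiSystem_inter (m₁ m₂ : MeasurableSpace Ω) :
    IsPiSystem {s | ∃ a c, MeasurableSet[m₁] a ∧ MeasurableSet[m₂] c ∧ a ∩ c = s} := by
  rintro _ ⟨a, c, ha, hc, rfl⟩ _ ⟨a', c', ha', hc', rfl⟩ _
  exact ⟨a ∩ a', c ∩ c', ha.inter ha', hc.inter hc', Set.inter_inter_inter_comm a a' c c'⟩

/-- Two integrable functions whose integrals agree on the intersections `a ∩ c` have the same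
integrals over the sets of the σ-algebra generated by these. -/
theorem setIntegral_eq_of_sup {m₁ m₂ : MeasurableSpace Ω} (h₁ : m₁ ≤ mΩ) (h₂ : m₂ ≤ mΩ)
    {f g : Ω → ℝ} (hf : Integrable f μ) (hg : Integrable g μ)
    (h : ∀ a c, MeasurableSet[m₁] a → MeasurableSet[m₂] c →
      ∫ ω in a ∩ c, f ω ∂μ = ∫ ω in a ∩ c, g ω ∂μ)
    (s : Set Ω) (hs : MeasurableSet[m₁ ⊔ m₂] s) :
    ∫ ω in s, f ω ∂μ = ∫ ω in s, g ω ∂μ := by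
  have hle : m₁ ⊔ m₂ ≤ mΩ := sup_le h₁ h₂
  have huniv : ∫ ω, f ω ∂μ = ∫ ω, g ω ∂μ := by
    simpa using h Set.univ Set.univ MeasurableSet.univ MeasurableSet.univ
  induction s, hs using MeasurableSpace.induction_on_inter
    (sup_eq_generateFrom_inter m₁ m₂) (isPiSystem_inter m₁ m₂) with
  | empty => simp
  | basic t ht =>
    obtain ⟨a, c, ha, hc, rfl⟩ := ht
    exact h a c ha hc
  | compl t ht ih =>
    rw [setIntegral_compl (hle _ ht) hf, setIntegral_compl (hle _ ht) hg, ih, huniv]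
  | iUnion u hd hm ih =>
    rw [integral_iUnion (fun i => hle _ (hm i)) hd hf.integrableOn,
      integral_iUnion (fun i => hle _ (hm i)) hd hg.integrableOn]
    exact tsum_congr ih

theorem integrable_indicator_one [IsFiniteMeasure μ] {s : Set Ω} (hs : MeasurableSet s) :
    Integrable (s.indicator fun _ => (1 : ℝ)) μ :=
  (integrable_const 1).indicator hs

theorem integrable_indicator_one_mul {s : Set Ω} (hs : MeasurableSet s) {g : Ω → ℝ}
    (hg : Integrable g μ) : Integrable ((s.indicator fun _ => (1 : ℝ)) * g) μ := by
  have : ((s.indicator fun _ => (1 : ℝ)) * g) = s.indicator g := by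
    ext ω; by_cases h : ω ∈ s <;> simp [h]
  rw [this]
  exact hg.indicator hs

theorem indicator_inter_one (s t : Set Ω) :
    ((s ∩ t).indicator fun _ => (1 : ℝ))
      = (s.indicator fun _ => (1 : ℝ)) * (t.indicator fun _ => (1 : ℝ)) := by
  funext ω
  simpa using! Set.inter_indicator_mul (s := s) (t := t) (fun _ : Ω => (1 : ℝ)) (fun _ => 1) ω

/-- If the conditional probability of every `b ∈ B` given `A ⊔ C` is that given `C`, then `A` and `B`
are conditionally independent given `C`. -/
theorem condIndepGiven_of_condExp_eq [IsProbabilityMeasure μ] {A B C : MeasurableSpace Ω}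
    (hA : A ≤ mΩ) (hB : B ≤ mΩ) (hC : C ≤ mΩ)
    (h : ∀ b, MeasurableSet[B] b → μ⟦b | A ⊔ C⟧ =ᵐ[μ] μ⟦b | C⟧) :
    CondIndepGiven C A B μ := by
  intro a b ha hb
  have hAC : A ⊔ C ≤ mΩ := sup_le hA hC
  have i_a := integrable_indicator_one (μ := μ) (hA _ ha)
  have i_b := integrable_indicator_one (μ := μ) (hB _ hb)
  have e₁ : μ⟦a ∩ b | A ⊔ C⟧ =ᵐ[μ] (a.indicator fun _ => (1 : ℝ)) * μ⟦b | C⟧ := by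
    rw [indicator_inter_one]
    refine (condExp_mul_of_stronglyMeasurable_left ?_
      (integrable_indicator_one_mul (hA _ ha) i_b) i_b).trans ?_
    · exact stronglyMeasurable_const.indicator ((le_sup_left : A ≤ A ⊔ C) _ ha)
    · filter_upwards [h b hb] with ω hω
      simp [hω]
  calc μ⟦a ∩ b | C⟧ =ᵐ[μ] μ[μ⟦a ∩ b | A ⊔ C⟧ | C] :=
        (condExp_condExp_of_le le_sup_right hAC).symm
    _ =ᵐ[μ] μ[(a.indicator fun _ => (1 : ℝ)) * μ⟦b | C⟧ | C] := condExp_congr_ae e₁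
    _ =ᵐ[μ] μ⟦a | C⟧ * μ⟦b | C⟧ :=
        condExp_mul_of_stronglyMeasurable_right stronglyMeasurable_condExp
          (integrable_indicator_one_mul (hA _ ha) integrable_condExp) i_a

/-- Converse of `condIndepGiven_of_condExp_eq`. It suffices to integrate over the sets a ∩ c. There,
conditioning on C and pulling out μ⟦b | C⟧ turns both integrals into integrals over c, which agree
by the product formula for a ∩ b. -/
theorem CondIndepGiven.condExp_indicator_eq [IsProbabilityMeasure μ] {A B C : MeasurableSpace Ω}
    (hA : A ≤ mΩ) (hB : B ≤ mΩ) (hC : C ≤ mΩ) (h : CondIndepGiven C A B μ)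
    {b : Set Ω} (hb : MeasurableSet[B] b) : μ⟦b | A ⊔ C⟧ =ᵐ[μ] μ⟦b | C⟧ := by
  have hAC : A ⊔ C ≤ mΩ := sup_le hA hC
  have i_b := integrable_indicator_one (μ := μ) (hB _ hb)
  have hm : StronglyMeasurable[A ⊔ C] (μ⟦b | C⟧) := stronglyMeasurable_condExp.mono le_sup_right
  refine (ae_eq_condExp_of_forall_setIntegral_eq hAC i_b
    (fun s _ _ => integrable_condExp.integrableOn) (fun s hs _ => ?_)
    hm.aestronglyMeasurable).symm
  refine setIntegral_eq_of_sup hA hC integrable_condExp i_b (fun a c ha hc => ?_) s hs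
  have i_a := integrable_indicator_one (μ := μ) (hA _ ha)
  have key : μ[(a.indicator fun _ => (1 : ℝ)) * μ⟦b | C⟧ | C] =ᵐ[μ] μ⟦a ∩ b | C⟧ :=
    (condExp_mul_of_stronglyMeasurable_right stronglyMeasurable_condExp
      (integrable_indicator_one_mul (hA _ ha) integrable_condExp) i_a).trans (h a b ha hb).symm
  have swap : ∀ g : Ω → ℝ, ∫ ω in a ∩ c, g ω ∂μ
      = ∫ ω in c, ((a.indicator fun _ => (1 : ℝ)) * g) ω ∂μ := by
    intro g
    have : ((a.indicator fun _ => (1 : ℝ)) * g) = a.indicator g := by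
      ext ω; by_cases h : ω ∈ a <;> simp [h]
    rw [this, setIntegral_indicator (hA _ ha), Set.inter_comm]
  rw [swap, swap, ← setIntegral_condExp hC
      (integrable_indicator_one_mul (hA _ ha) integrable_condExp) hc,
    ← setIntegral_condExp hC (integrable_indicator_one_mul (hA _ ha) i_b) hc]
  refine setIntegral_congr_ae (hC _ hc) ?_
  rw [← indicator_inter_one]
  filter_upwards [key] with ω hω _ using hω

/-- Conditional expectations of `m₁`-measurable functions are determined by those of indicators. -/
theorem condExp_eq_of_forall_indicator {m₁ V W : MeasurableSpace Ω} {mΩ : MeasurableSpace Ω}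
    {μ : Measure Ω} [IsProbabilityMeasure μ]
    (h₁ : m₁ ≤ mΩ) (hV : V ≤ mΩ) (hW : W ≤ mΩ)
    (h : ∀ s, MeasurableSet[m₁] s → μ⟦s | V⟧ =ᵐ[μ] μ⟦s | W⟧)
    {f : Ω → ℝ} (hf : StronglyMeasurable[m₁] f) (hfi : Integrable f μ) :
    μ[f | V] =ᵐ[μ] μ[f | W] := by
  rw [← memLp_one_iff_integrable] at hfi
  refine MemLp.induction_stronglyMeasurable h₁ ENNReal.one_ne_top
    (fun f => μ[f | V] =ᵐ[μ] μ[f | W]) ?_ ?_ ?_ ?_ hfi hf.aestronglyMeasurable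
  · intro c s hs _
    have hc : (s.indicator fun _ => c) = c • (s.indicator fun _ => (1 : ℝ)) := by
      ext ω; by_cases h : ω ∈ s <;> simp [h]
    rw [hc]
    refine (condExp_smul c _ V).trans (Filter.EventuallyEq.trans ?_ (condExp_smul c _ W).symm)
    filter_upwards [h s hs] with ω hω
    simp [hω]
  · intro u v _ hu hv _ _ hu' hv'
    rw [memLp_one_iff_integrable] at hu hv
    exact (condExp_add hu hv V).trans ((hu'.add hv').trans (condExp_add hu hv W).symm)
  -- The property is closed in L¹: it is the equalizer of two continuous operators.
  · have : {f : lpMeas ℝ ℝ m₁ 1 μ | μ[(f : Ω → ℝ) | V] =ᵐ[μ] μ[(f : Ω → ℝ) | W]}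
        = {f : lpMeas ℝ ℝ m₁ 1 μ | condExpL1CLM ℝ hV μ (f : Lp ℝ 1 μ)
            = condExpL1CLM ℝ hW μ (f : Lp ℝ 1 μ)} := by
      ext f
      have hfi : Integrable ((f : Lp ℝ 1 μ) : Ω → ℝ) μ := L1.integrable_coeFn _
      have e : ∀ {m : MeasurableSpace Ω} (hm : m ≤ mΩ), μ[(f : Ω → ℝ) | m] =ᵐ[μ]
          condExpL1CLM ℝ hm μ (f : Lp ℝ 1 μ) := by
        intro m hm
        refine (condExp_ae_eq_condExpL1CLM hm hfi).trans ?_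
        rw [Integrable.toL1_coeFn]
      simp only [Set.mem_ofPred_eq]
      constructor
      · intro hh
        exact Lp.ext ((e hV).symm.trans (hh.trans (e hW)))
      · intro hh
        exact (e hV).trans ((Filter.EventuallyEq.of_eq (by rw [hh])).trans (e hW).symm)
    rw [this]
    exact isClosed_eq ((condExpL1CLM ℝ hV μ).continuous.comp continuous_subtype_val)
      ((condExpL1CLM ℝ hW μ).continuous.comp continuous_subtype_val)
  · intro u v huv _ hu
    exact (condExp_congr_ae huv).symm.trans (hu.trans (condExp_congr_ae huv))

theorem CondIndepGiven.symm {A B C : MeasurableSpace Ω} (h : CondIndepGiven C A B μ) :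
    CondIndepGiven C B A μ := by
  intro b a hb ha
  rw [Set.inter_comm, mul_comm]
  exact h a b ha hb

theorem CondIndepGiven.mono {A B A' B' C : MeasurableSpace Ω} (h : CondIndepGiven C A B μ)
    (hA : A' ≤ A) (hB : B' ≤ B) : CondIndepGiven C A' B' μ :=
  fun a b ha hb => h a b (hA _ ha) (hB _ hb)

/-- If `U` is independent of `V ≥ C`, then `U ⊔ C` and `V` are conditionally independent given `C`. -/
theorem condIndepGiven_of_indep [IsProbabilityMeasure μ] {U V C : MeasurableSpace Ω}
    (hU : U ≤ mΩ) (hV : V ≤ mΩ) (hCV : C ≤ V) (h : Indep U V μ) :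
    CondIndepGiven C (U ⊔ C) V μ := by
  have hC : C ≤ mΩ := hCV.trans hV
  refine condIndepGiven_of_condExp_eq (sup_le hU hC) hV hC fun v hv => ?_
  rw [sup_assoc, sup_idem]
  have i_v := integrable_indicator_one (μ := μ) (hV _ hv)
  have hm : StronglyMeasurable[U ⊔ C] (μ⟦v | C⟧) := stronglyMeasurable_condExp.mono le_sup_right
  refine (ae_eq_condExp_of_forall_setIntegral_eq (sup_le hU hC) i_v
    (fun s _ _ => integrable_condExp.integrableOn) (fun s hs _ => ?_)
    hm.aestronglyMeasurable).symm
  refine setIntegral_eq_of_sup hU hC integrable_condExp i_v (fun u c hu hc => ?_) s hs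
  -- Independence of U and V factors out the probability of u, since the indicator of c times g is
  -- V-measurable.
  have split : ∀ g : Ω → ℝ, StronglyMeasurable[V] g → Integrable g μ →
      ∫ ω in u ∩ c, g ω ∂μ = μ.real u * ∫ ω in c, g ω ∂μ := by
    intro g hg hgi
    have hgm : StronglyMeasurable[V] (c.indicator g) := hg.indicator (hCV _ hc)
    have hgi' : Integrable (c.indicator g) μ := hgi.indicator (hC _ hc)
    rw [← setIntegral_indicator (hC _ hc), ← setIntegral_condExp hU hgi' hu,
      setIntegral_congr_ae (hU _ hu) (g := fun _ => ∫ ω, c.indicator g ω ∂μ)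
        (by filter_upwards [condExp_indep_eq hV hU hgm h.symm] with ω hω _ using hω),
      setIntegral_const, integral_indicator (hC _ hc), smul_eq_mul]
  rw [split _ (stronglyMeasurable_condExp.mono hCV) integrable_condExp,
    split _ (stronglyMeasurable_const.indicator hv) i_v, setIntegral_condExp hC i_v hc]

/-- If `A` and `B` are conditionally independent given `C`, a centred `A ⊔ C`-measurable variable
which is independent of `C` is uncorrelated with every `B`-measurable one. -/
theorem CondIndepGiven.integral_mul_eq_zero [IsProbabilityMeasure μ] {A B C : MeasurableSpace Ω}
    (hA : A ≤ mΩ) (hB : B ≤ mΩ) (hC : C ≤ mΩ) (h : CondIndepGiven C A B μ)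
    {t f : Ω → ℝ} (ht : StronglyMeasurable[A ⊔ C] t) (hf : StronglyMeasurable[B] f)
    (hfi : Integrable f μ) (htf : Integrable (t * f) μ)
    (hind : Indep (MeasurableSpace.comap t inferInstance) C μ) (ht0 : ∫ ω, t ω ∂μ = 0) :
    ∫ ω, t ω * f ω ∂μ = 0 := by
  have hAC : A ⊔ C ≤ mΩ := sup_le hA hC
  have e : μ[f | A ⊔ C] =ᵐ[μ] μ[f | C] := condExp_eq_of_forall_indicator hB hAC hC
    (fun s hs => h.condExp_indicator_eq hA hB hC hs) hf hfi
  have e' : μ[t * f | A ⊔ C] =ᵐ[μ] t * μ[f | C] := by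
    refine (condExp_mul_of_stronglyMeasurable_left ht htf hfi).trans ?_
    filter_upwards [e] with ω hω
    simp [hω]
  have hindep : IndepFun t μ[f | C] μ := by
    rw [IndepFun_iff_Indep]
    exact indep_of_indep_of_le_right hind stronglyMeasurable_condExp.measurable.comap_le
  calc ∫ ω, t ω * f ω ∂μ = ∫ ω, (μ[t * f | A ⊔ C]) ω ∂μ := (integral_condExp hAC).symm
    _ = ∫ ω, (t * μ[f | C]) ω ∂μ := integral_congr_ae e'
    _ = 0 := by
      rw [hindep.integral_mul_eq_mul_integral (ht.mono hAC).aestronglyMeasurable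
        integrable_condExp.aestronglyMeasurable, ht0, zero_mul]

end CondIndep

/-- A positive definite system can be solved on any set of indices by a vector supported there. -/
theorem exists_supported_mulVec_eq {ι : Type*} [Fintype ι] {S : Matrix ι ι ℝ}
    (hS : S.PosDef) (I : Set ι) (f : ι → ℝ) :
    ∃ c : ι → ℝ, (∀ p ∉ I, c p = 0) ∧ ∀ q ∈ I, (S *ᵥ c) q = f q := by
  classical
  set S' := S.submatrix (Subtype.val : I → ι) Subtype.val with hS'
  have hu : IsUnit S'.det :=
    ((hS.submatrix (e := (Subtype.val : I → ι)) Subtype.val_injective).det_pos).ne'.isUnit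
  set c' := S'⁻¹ *ᵥ fun q : I => f q with hc'
  refine ⟨fun p => if h : p ∈ I then c' ⟨p, h⟩ else 0, fun p hp => dif_neg hp, fun q hq => ?_⟩
  have h1 : S' *ᵥ c' = fun q : I => f q := by
    rw [hc', mulVec_mulVec, mul_nonsing_inv _ hu, one_mulVec]
  have h2 := congrFun h1 ⟨q, hq⟩
  rw [← h2]
  simp only [mulVec, dotProduct]
  rw [← Fintype.sum_subtype_add_sum_subtype (fun p => p ∈ I)]
  rw [Finset.sum_eq_zero (s := (Finset.univ : Finset {p // p ∉ I})), add_zero]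
  · refine Finset.sum_congr rfl fun p _ => ?_
    rw [dif_pos p.2]
    rfl
  · intro p _
    rw [dif_neg p.2, mul_zero]

/-! ### Jointly Gaussian families and the inverse covariance matrix -/

section Gaussian

variable {Ω ι : Type*} [Fintype ι]

/-- The linear combination of the family `X` with coefficients `c`. -/
def lin (X : ι → Ω → ℝ) (c : ι → ℝ) (ω : Ω) : ℝ := ∑ p, c p * X p ω

/-- The σ-algebra generated by the variables `X p`, `p ∈ S`. -/
@[reducible]
def sigmaFam {ι : Type*} (X : ι → Ω → ℝ) (S : Set ι) : MeasurableSpace Ω :=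
  ⨆ p ∈ S, MeasurableSpace.comap (X p) inferInstance

theorem sigmaFam_mono {ι : Type*} (X : ι → Ω → ℝ) {S T : Set ι} (h : S ⊆ T) :
    sigmaFam X S ≤ sigmaFam X T :=
  biSup_mono h

theorem sigmaFam_union {ι : Type*} (X : ι → Ω → ℝ) (S T : Set ι) :
    sigmaFam X (S ∪ T) = sigmaFam X S ⊔ sigmaFam X T :=
  iSup_union

theorem measurable_sigmaFam {ι : Type*} (X : ι → Ω → ℝ) {S : Set ι} {p : ι} (hp : p ∈ S) :
    Measurable[sigmaFam X S] (X p) := by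
  rw [measurable_iff_comap_le]
  exact le_iSup₂_of_le p hp le_rfl

theorem measurable_lin (X : ι → Ω → ℝ) {S : Set ι} {c : ι → ℝ} (hc : ∀ p ∉ S, c p = 0) :
    Measurable[sigmaFam X S] (lin X c) := by
  refine Finset.measurable_fun_sum _ fun p _ => ?_
  by_cases hp : p ∈ S
  · exact (measurable_sigmaFam X hp).const_mul _
  · simp [hc p hp]

theorem lin_single [DecidableEq ι] (X : ι → Ω → ℝ) (p : ι) : lin X (Pi.single p 1) = X p := by
  funext ω
  simp [lin, Pi.single_apply]

theorem lin_lin {κ : Type*} [Fintype κ] (X : ι → Ω → ℝ) (T : Matrix κ ι ℝ) (c : κ → ℝ) :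
    lin (fun k => lin X (T k)) c = lin X (c ᵥ* T) := by
  funext ω
  simp only [lin, vecMul, dotProduct, Finset.mul_sum, Finset.sum_mul]
  rw [Finset.sum_comm]
  exact Finset.sum_congr rfl fun p _ => Finset.sum_congr rfl fun k _ => by ring

variable {mΩ : MeasurableSpace Ω}

/-- A jointly Gaussian family of centred random variables. -/
structure IsCentredGaussian (μ : Measure Ω) (X : ι → Ω → ℝ) : Prop where
  measurable : ∀ p, Measurable (X p)
  gaussian : HasGaussianLaw (fun ω p => X p ω) μ
  zero_mean : ∀ p, ∫ ω, X p ω ∂μ = 0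

/-- The covariance matrix of a family of random variables. -/
def famCov {ι : Type*} (μ : Measure Ω) (X : ι → Ω → ℝ) : Matrix ι ι ℝ :=
  Matrix.of fun p q => cov[X p, X q; μ]

variable {μ : Measure Ω} [IsProbabilityMeasure μ] {X : ι → Ω → ℝ}

namespace IsCentredGaussian

omit [Fintype ι] [IsProbabilityMeasure μ] in
theorem memLp (h : IsCentredGaussian μ X) (p : ι) : MemLp (X p) 2 μ :=
  (h.gaussian.eval p).memLp_two

omit [Fintype ι] [IsProbabilityMeasure μ] in
theorem sigmaFam_le (h : IsCentredGaussian μ X) (S : Set ι) : sigmaFam X S ≤ mΩ :=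
  iSup₂_le fun p _ => (h.measurable p).comap_le

theorem covariance_lin (h : IsCentredGaussian μ X) (c c' : ι → ℝ) :
    cov[lin X c, lin X c'; μ] = c ⬝ᵥ (famCov μ X *ᵥ c') := by
  have := covariance_fun_sum_fun_sum (μ := μ) (X := fun p ω => c p * X p ω)
    (Y := fun p ω => c' p * X p ω) (fun p => (h.memLp p).const_mul _)
    (fun p => (h.memLp p).const_mul _)
  refine this.trans ?_
  simp only [dotProduct, mulVec, Finset.mul_sum, covariance_const_mul_left,
    covariance_const_mul_right]
  exact Finset.sum_congr rfl fun p _ => Finset.sum_congr rfl fun q _ => by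
    simp only [famCov, of_apply]; ring

theorem lin_family (h : IsCentredGaussian μ X) {κ : Type*} [Fintype κ] (T : Matrix κ ι ℝ) :
    IsCentredGaussian μ fun k => lin X (T k) where
  measurable k := Finset.measurable_fun_sum _ fun p _ => (h.measurable p).const_mul _
  gaussian := h.gaussian.map_fun (LinearMap.toContinuousLinearMap (Matrix.mulVecLin T))
  zero_mean k := by
    simp only [lin]
    rw [integral_finsetSum _ fun p _ => ((h.memLp p).integrable (by norm_num)).const_mul _]
    exact Finset.sum_eq_zero fun p _ => by rw [integral_const_mul, h.zero_mean, mul_zero]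

theorem famCov_lin (h : IsCentredGaussian μ X) {κ : Type*} [Fintype κ] (T : Matrix κ ι ℝ) :
    famCov μ (fun k => lin X (T k)) = T * famCov μ X * Tᵀ := by
  ext k l
  rw [famCov, of_apply, h.covariance_lin, Matrix.mul_assoc]
  rfl

/-- Uncorrelated families of linear combinations are independent. -/
theorem indep_lin (h : IsCentredGaussian μ X) {κ κ' : Type*} [Fintype κ] [Fintype κ']
    (c : κ → ι → ℝ) (c' : κ' → ι → ℝ) (hc : ∀ k k', c k ⬝ᵥ (famCov μ X *ᵥ c' k') = 0) :
    Indep (⨆ k, MeasurableSpace.comap (lin X (c k)) inferInstance)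
      (⨆ k, MeasurableSpace.comap (lin X (c' k)) inferInstance) μ := by
  have hG : HasGaussianLaw (fun ω => (fun k => lin X (c k) ω, fun k => lin X (c' k) ω)) μ :=
    h.gaussian.map_fun (LinearMap.toContinuousLinearMap
      ((Matrix.mulVecLin (Matrix.of c)).prod (Matrix.mulVecLin (Matrix.of c'))))
  have := hG.indepFun_of_covariance_eval fun k k' => (h.covariance_lin _ _).trans (hc k k')
  rw [IndepFun_iff_Indep, MeasurableSpace.pi, MeasurableSpace.pi, MeasurableSpace.comap_iSup,
    MeasurableSpace.comap_iSup] at this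
  simpa only [MeasurableSpace.comap_comp, Function.comp_def] using! this

theorem indep_lin_sigmaFam (h : IsCentredGaussian μ X) {κ : Type*} [Fintype κ]
    (c : κ → ι → ℝ) (S : Set ι) (hc : ∀ k, ∀ q ∈ S, (famCov μ X *ᵥ c k) q = 0) :
    Indep (⨆ k, MeasurableSpace.comap (lin X (c k)) inferInstance) (sigmaFam X S) μ := by
  classical
  have := h.indep_lin (fun q : S => Pi.single (q : ι) 1) c
    fun q k => by rw [single_one_dotProduct]; exact hc k q q.2
  simp only [lin_single] at this
  rw [sigmaFam, iSup_subtype']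
  exact this.symm

/-- If `A` and `B` are conditionally independent given `C`, every combination over `A ∪ C` which is
uncorrelated with `C` is uncorrelated with `B`. -/
theorem famCov_mulVec_eq_zero (h : IsCentredGaussian μ X) {A B C : Set ι}
    (hci : CondIndepGiven (sigmaFam X C) (sigmaFam X A) (sigmaFam X B) μ) {c : ι → ℝ}
    (hc : ∀ p ∉ A ∪ C, c p = 0) (hcC : ∀ q ∈ C, (famCov μ X *ᵥ c) q = 0) :
    ∀ b ∈ B, (famCov μ X *ᵥ c) b = 0 := by
  classical
  intro b hb
  have hl := h.lin_family (Matrix.of fun _ : Unit => c)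
  have hind := h.indep_lin_sigmaFam (fun _ : Unit => c) C fun _ => hcC
  rw [iSup_unique] at hind
  have ht : MemLp (lin X c) 2 μ := hl.memLp ()
  have key := hci.integral_mul_eq_zero (h.sigmaFam_le A) (h.sigmaFam_le B) (h.sigmaFam_le C)
    (t := lin X c) (f := X b)
    (by rw [← sigmaFam_union]; exact (measurable_lin X hc).stronglyMeasurable)
    (measurable_sigmaFam X hb).stronglyMeasurable ((h.memLp b).integrable (by norm_num))
    (ht.integrable_mul (h.memLp b)) hind (hl.zero_mean ())
  have hcov := h.covariance_lin (Pi.single b 1) c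
  rw [lin_single, single_one_dotProduct, covariance_comm, covariance_eq_sub ht (h.memLp b),
    h.zero_mean, mul_zero, sub_zero] at hcov
  rw [← hcov]
  exact key

/-- Conditional independence in a nonsingular centred Gaussian family is the vanishing of a block
of the inverse covariance matrix. -/
theorem condIndepGiven_iff [DecidableEq ι] (h : IsCentredGaussian μ X) (hS : (famCov μ X).PosDef)
    {A B C : Set ι} (hABC : ∀ p, p ∈ A ∨ p ∈ B ∪ C) (hA : ∀ p ∈ A, p ∉ B ∪ C)
    (hB : ∀ p ∈ B, p ∉ C) :
    CondIndepGiven (sigmaFam X C) (sigmaFam X A) (sigmaFam X B) μ ↔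
      ∀ a ∈ A, ∀ b ∈ B, (famCov μ X)⁻¹ a b = 0 := by
  have hu : IsUnit (famCov μ X).det := hS.det_pos.ne'.isUnit
  set S := famCov μ X with hSdef
  constructor
  · intro hci a ha b hb
    -- The combination t of the variables over B ∪ C is uncorrelated with C, hence with A by
    -- conditional independence. So S t is the unit vector at b everywhere, and t is column b of
    -- S⁻¹, which therefore vanishes on A.
    obtain ⟨t, ht, hSt⟩ := exists_supported_mulVec_eq hS (B ∪ C) (Pi.single b 1)
    have h0 := h.famCov_mulVec_eq_zero hci.symm ht fun q hq => by
      rw [← hSdef, hSt q (Or.inr hq), Pi.single_eq_of_ne]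
      rintro rfl
      exact hB _ hb hq
    have hfull : S *ᵥ t = Pi.single b 1 := by
      funext p
      rcases hABC p with hp | hp
      · rw [Pi.single_eq_of_ne, h0 p hp]
        rintro rfl
        exact hA _ hp (Or.inl hb)
      · exact hSt p hp
    have : t = S⁻¹ *ᵥ Pi.single b 1 := by
      rw [← hfull, mulVec_mulVec, nonsing_inv_mul _ hu, one_mulVec]
    have h1 := ht a (hA a ha)
    rwa [this, mulVec_single_one] at h1
  · classical
    intro hP
    have hsymm : S⁻¹ᵀ = S⁻¹ := by
      have := hS.inv.isHermitian
      rwa [IsHermitian, conjTranspose_eq_transpose_of_trivial] at this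
    -- The dual variables Z_a, with the columns of S⁻¹ as coefficients, satisfy Cov(Z_a, X_q) =
    -- δ_{aq}; those with a ∈ A are thus independent of B ∪ C.
    have hind := h.indep_lin_sigmaFam (fun a : A => S⁻¹ *ᵥ Pi.single (a : ι) 1) (B ∪ C)
      fun a q hq => by
        rw [mulVec_mulVec, ← hSdef, mul_nonsing_inv _ hu, one_mulVec, Pi.single_eq_of_ne]
        rintro rfl
        exact hA _ a.2 hq
    set Z : ι → Ω → ℝ := fun a => lin X (S⁻¹ *ᵥ Pi.single a 1) with hZ
    have hU : (⨆ a : A, MeasurableSpace.comap (lin X (S⁻¹ *ᵥ Pi.single (a : ι) 1)) inferInstance)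
        = sigmaFam Z A := by
      rw [sigmaFam, iSup_subtype']
    rw [hU] at hind
    have hZm := h.lin_family (Matrix.of fun a => S⁻¹ *ᵥ Pi.single a 1)
    have hci := condIndepGiven_of_indep (U := sigmaFam Z A) (hZm.sigmaFam_le A)
      (h.sigmaFam_le (B ∪ C)) (sigmaFam_mono X Set.subset_union_right) hind
    refine hci.mono ?_ (sigmaFam_mono X Set.subset_union_left)
    refine iSup₂_le fun a ha => measurable_iff_comap_le.1 ?_
    -- X_a is recovered from Z_A and X_C: S⁻¹ c minus the unit vector at a vanishes on A by the
    -- choice of c, and on B because the block of S⁻¹ vanishes.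
    obtain ⟨c, hc, hPc⟩ := exists_supported_mulVec_eq hS.inv A (Pi.single a 1)
    have hXa : X a = fun ω => lin Z c ω - lin X (S⁻¹ *ᵥ c - Pi.single a 1) ω := by
      have e : lin Z c = lin X (S⁻¹ *ᵥ c) := by
        rw [hZ]
        have : (fun a => lin X (S⁻¹ *ᵥ Pi.single a 1)) = fun a => lin X (S⁻¹ a) := by
          funext a
          rw [mulVec_single_one]
          conv_rhs => rw [← hsymm]
          rfl
        rw [this, lin_lin, ← vecMul_transpose, hsymm]
      funext ω
      rw [e, ← congrFun (lin_single X a) ω]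
      simp only [lin, Pi.sub_apply, sub_mul, Finset.sum_sub_distrib]
      ring
    rw [hXa]
    refine Measurable.sub ?_ ?_
    · exact (measurable_lin Z hc).mono le_sup_left le_rfl
    · refine (measurable_lin X fun p hp => ?_).mono le_sup_right le_rfl
      rw [Pi.sub_apply, sub_eq_zero]
      rcases hABC p with hpA | hpB | hpC
      · exact hPc p hpA
      · rw [Pi.single_eq_of_ne]
        · refine Finset.sum_eq_zero fun q _ => ?_
          by_cases hq : q ∈ A
          · exact mul_eq_zero_of_left
              ((congrFun (congrFun hsymm p) q).symm.trans (hP q hq p hpB)) _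
          · rw [hc q hq, mul_zero]
        · rintro rfl
          exact hA _ ha (Or.inl hpB)
      · exact absurd hpC hp

end IsCentredGaussian

end Gaussian

/-! ### Reciprocity as a sparsity pattern of the inverse covariance -/

section Reciprocal

variable {Ω : Type*} {d N : ℕ}

/-- The coordinates of the stacked vector `(x_0, …, x_N)`. -/
def coord (N : ℕ) (x : ℕ → Ω → (Fin d → ℝ)) (p : Fin (N + 1) × Fin d) (ω : Ω) : ℝ :=
  x p.1 ω p.2

theorem sigmaOf_eq_sigmaFam (x : ℕ → Ω → (Fin d → ℝ)) {S : Set ℕ} (hS : ∀ i ∈ S, i ≤ N) :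
    sigmaOf x S = sigmaFam (coord N x) {p | (p.1 : ℕ) ∈ S} := by
  have hpi : ∀ i, MeasurableSpace.comap (x i) inferInstance
      = ⨆ a, MeasurableSpace.comap (fun ω => x i ω a) inferInstance := by
    intro i
    rw [MeasurableSpace.pi, MeasurableSpace.comap_iSup]
    simp only [MeasurableSpace.comap_comp, Function.comp_def]
  refine le_antisymm (iSup₂_le fun i hi => ?_) (iSup₂_le fun p hp => ?_)
  · rw [hpi]
    exact iSup_le fun a => le_iSup₂_of_le (f := fun p (_ : p ∈ {p : Fin (N + 1) × Fin d |
      (p.1 : ℕ) ∈ S}) => MeasurableSpace.comap (coord N x p) inferInstance)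
      ((⟨i, Nat.lt_succ_of_le (hS i hi)⟩, a) : Fin (N + 1) × Fin d) hi le_rfl
  · refine le_iSup₂_of_le (p.1 : ℕ) hp ?_
    rw [hpi]
    exact le_iSup_of_le p.2 le_rfl

variable [MeasurableSpace Ω] {μ : Measure Ω} {x : ℕ → Ω → (Fin d → ℝ)}

theorem famCov_coord : famCov μ (coord N x) = covMatrix N μ x := rfl

theorem IsZMNG.isCentredGaussian (h : IsZMNG N μ x) : IsCentredGaussian μ (coord N x) where
  measurable p := (measurable_pi_apply p.2).comp (h.measurable p.1 (Nat.le_of_lt_succ p.1.2))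
  gaussian := h.gaussian.map_fun (ContinuousLinearMap.pi fun p : Fin (N + 1) × Fin d =>
    (ContinuousLinearMap.proj p.2 : (Fin d → ℝ) →L[ℝ] ℝ).comp (ContinuousLinearMap.proj p.1 :
        (Fin (N + 1) → Fin d → ℝ) →L[ℝ] (Fin d → ℝ)))
  zero_mean p := by
    have hi : ∀ a, Integrable (fun ω => x p.1 ω a) μ := fun a =>
      ((h.gaussian.eval p.1).eval a).integrable
    have := congrFun (h.zero_mean p.1 (Nat.le_of_lt_succ p.1.2)) p.2
    rwa [eval_integral hi] at this

theorem IsCentredGaussian.isZMNG (h : IsCentredGaussian μ (coord N x))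
    (hS : (covMatrix N μ x).PosDef) : IsZMNG N μ x where
  measurable k hk := measurable_pi_iff.2 fun a => h.measurable (⟨k, Nat.lt_succ_of_le hk⟩, a)
  gaussian := h.gaussian.map_fun (ContinuousLinearMap.pi fun k : Fin (N + 1) =>
    ContinuousLinearMap.pi fun a : Fin d =>
      (ContinuousLinearMap.proj (k, a) : (Fin (N + 1) × Fin d → ℝ) →L[ℝ] ℝ))
  zero_mean k hk := by
    have hi : ∀ a, Integrable (fun ω => x k ω a) μ := fun a =>
      (h.gaussian.eval (⟨k, Nat.lt_succ_of_le hk⟩, a)).integrable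
    funext a
    rw [eval_integral hi]
    exact h.zero_mean (⟨k, Nat.lt_succ_of_le hk⟩, a)
  nonsingular := hS

variable [IsProbabilityMeasure μ]

/-- `[x_k]` is reciprocal iff the blocks of the inverse covariance matrix in the rows `1, …, N-1`
vanish outside the three central diagonals. -/
theorem IsZMNG.isReciprocal_iff (h : IsZMNG N μ x) :
    IsReciprocal N μ x ↔ ∀ p q : Fin (N + 1) × Fin d, 1 ≤ (p.1 : ℕ) → (p.1 : ℕ) < N →
      (q.1 : ℕ) ≠ p.1 → (q.1 : ℕ) + 1 ≠ p.1 → (q.1 : ℕ) ≠ p.1 + 1 →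
        (covMatrix N μ x)⁻¹ p q = 0 := by
  have key : ∀ j l : ℕ, j < l → l ≤ N →
      (CondIndepGiven (sigmaOf x {j, l}) (sigmaOf x {i | j < i ∧ i < l})
        (sigmaOf x {i | i ≤ N ∧ (i < j ∨ l < i)}) μ ↔
      ∀ p ∈ {p : Fin (N + 1) × Fin d | (p.1 : ℕ) ∈ {i | j < i ∧ i < l}},
        ∀ q ∈ {q : Fin (N + 1) × Fin d | (q.1 : ℕ) ∈ {i | i ≤ N ∧ (i < j ∨ l < i)}},
          (famCov μ (coord N x))⁻¹ p q = 0) := by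
    intro j l hjl hl
    rw [sigmaOf_eq_sigmaFam (N := N) x (S := {j, l}), sigmaOf_eq_sigmaFam (N := N) x,
      sigmaOf_eq_sigmaFam (N := N) x]
    · refine h.isCentredGaussian.condIndepGiven_iff h.nonsingular ?_ ?_ ?_
      all_goals intro p
      all_goals have := p.1.2
      all_goals simp only [Set.mem_union, Set.mem_ofPred_eq, Set.mem_insert_iff,
        Set.mem_singleton_iff]
      all_goals omega
    all_goals intro i
    all_goals simp only [Set.mem_ofPred_eq, Set.mem_insert_iff, Set.mem_singleton_iff]
    all_goals omega
  constructor
  · intro hr p q h1 h2 hq1 hq2 hq3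
    have := q.1.2
    -- The shortest windows, with the time of p as their only interior point, already give every
    -- required zero.
    exact (key (p.1 - 1) (p.1 + 1) (by omega) (by omega)).1 (hr _ _ (by omega) (by omega))
      p (by simp only [Set.mem_ofPred_eq]; omega) q (by simp only [Set.mem_ofPred_eq]; omega)
  · intro hP j l hjl hl
    refine (key j l hjl hl).2 fun p hp q hq => ?_
    simp only [Set.mem_ofPred_eq] at hp hq
    exact hP p q (by omega) (by omega) (by omega) (by omega) (by omega)

end Reciprocal

/-! ### `CM_L` models and the backward recursion -/

section Model

variable {Ω : Type*} {d : ℕ}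

namespace CMLParams

/-- The blocks of the matrix that maps `(x_0, …, x_N)` to `(e_0, …, e_N)` in a `CM_L` model. -/
def blocks (N : ℕ) (G : CMLParams d) :
    Matrix (Fin (N + 1)) (Fin (N + 1)) (Matrix (Fin d) (Fin d) ℝ) :=
  Matrix.of fun k j => (if (j : ℕ) = k then 1 else 0)
    - (if 1 ≤ (k : ℕ) ∧ (k : ℕ) < N ∧ (j : ℕ) = k - 1 then G.Gprev k else 0)
    - (if (k : ℕ) < N ∧ (j : ℕ) = N then G.Gend k else 0)

/-- The matrix that maps `(x_0, …, x_N)` to `(e_0, …, e_N)` in a `CM_L` model. -/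
def toMatrix (N : ℕ) (G : CMLParams d) :
    Matrix (Fin (N + 1) × Fin d) (Fin (N + 1) × Fin d) ℝ :=
  Matrix.comp _ _ _ _ ℝ (G.blocks N)

/-- The noise sequence of a `CM_L` model. -/
def noise (N : ℕ) (G : CMLParams d) (x : ℕ → Ω → (Fin d → ℝ)) (k : ℕ) (ω : Ω) : Fin d → ℝ :=
  x k ω - (if 1 ≤ k ∧ k < N then G.Gprev k *ᵥ x (k - 1) ω else 0)
    - (if k < N then G.Gend k *ᵥ x N ω else 0)

theorem sum_ite_val_eq_mulVec {N : ℕ} (v : ℕ → Fin d → ℝ) (P : Prop) [Decidable P]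
    (A : Matrix (Fin d) (Fin d) ℝ) {m : ℕ} (hm : m ≤ N) :
    ∑ j : Fin (N + 1), (if P ∧ (j : ℕ) = m then A else 0) *ᵥ v j = if P then A *ᵥ v m else 0 := by
  rw [Finset.sum_eq_single (⟨m, Nat.lt_succ_of_le hm⟩ : Fin (N + 1))]
  · by_cases hP : P <;> simp [hP]
  · intro j _ hj
    rw [if_neg, zero_mulVec]
    exact fun h => hj (Fin.ext h.2)
  · simp

theorem coord_noise (N : ℕ) (G : CMLParams d) (x : ℕ → Ω → (Fin d → ℝ)) :
    coord N (G.noise N x) = fun p => lin (coord N x) (G.toMatrix N p) := by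
  funext ⟨k, a⟩ ω
  have h : lin (coord N x) (G.toMatrix N (k, a)) ω
      = (∑ j : Fin (N + 1), G.blocks N k j *ᵥ x j ω) a := by
    rw [lin, Fintype.sum_prod_type, Finset.sum_apply]
    rfl
  rw [h]
  have hk := Nat.le_of_lt_succ k.2
  have h1 := sum_ite_val_eq_mulVec (fun i => x i ω) True (1 : Matrix (Fin d) (Fin d) ℝ) hk
  have h2 := sum_ite_val_eq_mulVec (fun i => x i ω) (1 ≤ (k : ℕ) ∧ (k : ℕ) < N) (G.Gprev k)
    ((Nat.sub_le (k : ℕ) 1).trans hk)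
  have h3 := sum_ite_val_eq_mulVec (fun i => x i ω) ((k : ℕ) < N) (G.Gend k) (le_refl N)
  simp only [true_and, if_true, one_mulVec, and_assoc] at h1 h2 h3
  simp only [blocks, of_apply, sub_mulVec, Finset.sum_sub_distrib, h1, h2, h3]
  rfl

variable [MeasurableSpace Ω] {μ : Measure Ω} {x : ℕ → Ω → (Fin d → ℝ)} {N : ℕ} {G : CMLParams d}

theorem famCov_congr {ι : Type*} {X Y : ι → Ω → ℝ} (h : ∀ p, X p =ᵐ[μ] Y p) :
    famCov μ X = famCov μ Y := by
  ext p q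
  simp only [famCov, of_apply, covariance]
  rw [integral_congr_ae (h p), integral_congr_ae (h q)]
  refine integral_congr_ae ?_
  filter_upwards [h p, h q] with ω h1 h2
  rw [h1, h2]

theorem covMatrix_eq_comp_diagonal {e : ℕ → Ω → (Fin d → ℝ)} {D : ℕ → Matrix (Fin d) (Fin d) ℝ}
    (hw : ∀ i ≤ N, ∀ j ≤ N, i ≠ j → crossCov μ (e i) (e j) = 0)
    (hc : ∀ k ≤ N, crossCov μ (e k) (e k) = D k) :
    covMatrix N μ e = Matrix.comp _ _ _ _ ℝ (Matrix.diagonal fun k : Fin (N + 1) => D k) := by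
  ext ⟨i, a⟩ ⟨j, b⟩
  have hi := Nat.le_of_lt_succ i.2
  by_cases hij : i = j
  · subst hij
    simp [covMatrix, hc i hi]
  · have := hw i hi j (Nat.le_of_lt_succ j.2) (fun h => hij (Fin.ext h))
    simp [covMatrix, hij, this]

variable [IsProbabilityMeasure μ]

/-- The model equations identify e almost surely with the linear image of x under `toMatrix`, so
both have the same covariance, and that of e is block diagonal by whiteness. -/
theorem IsModelOf.noise_covariance (hx : IsZMNG N μ x) (hN : 1 ≤ N) (h : G.IsModelOf N μ x) :
    (∀ k ≤ N, (G.Gcov k).PosDef) ∧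
    G.toMatrix N * covMatrix N μ x * (G.toMatrix N)ᵀ
      = Matrix.comp _ _ _ _ ℝ (Matrix.diagonal fun k : Fin (N + 1) => G.Gcov k) := by
  obtain ⟨e, he, hc, hm, hN', h0⟩ := h
  have hcomp := covMatrix_eq_comp_diagonal he.white hc
  refine ⟨fun k hk => ?_, ?_⟩
  · have := he.zmng.nonsingular.submatrix (e := fun a : Fin d => ((⟨k, Nat.lt_succ_of_le hk⟩, a) :
      Fin (N + 1) × Fin d)) (fun a b hab => (Prod.ext_iff.1 hab).2)
    rw [← hc k hk]
    exact this
  · rw [← hcomp, ← famCov_coord, ← famCov_coord, ← hx.isCentredGaussian.famCov_lin, ← coord_noise]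
    refine famCov_congr fun p => ?_
    have hp := Nat.le_of_lt_succ p.1.2
    have key : ∀ᵐ ω ∂μ, G.noise N x p.1 ω = e p.1 ω := by
      rcases Nat.eq_zero_or_pos (p.1 : ℕ) with hp0 | hp0
      · rw [hp0]
        filter_upwards [h0] with ω hω
        have : 0 < N := hN
        simp [noise, this, hω]
      · rcases hp.lt_or_eq with hlt | heq
        · filter_upwards [hm p.1 hp0 hlt] with ω hω
          have : 1 ≤ (p.1 : ℕ) := hp0
          rw [noise, if_pos ⟨this, hlt⟩, if_pos hlt, hω]
          abel
        · rw [heq]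
          filter_upwards [hN'] with ω hω
          simp [noise, hω]
    filter_upwards [key] with ω hω
    exact congrFun hω p.2

/-- The inverse covariance matrix of a sequence with a `CM_L` model, in terms of the model. -/
theorem IsModelOf.inv_covMatrix (hx : IsZMNG N μ x) (hN : 1 ≤ N) (h : G.IsModelOf N μ x) :
    (covMatrix N μ x)⁻¹ = Matrix.comp _ _ _ _ ℝ (Matrix.of fun i j =>
      ∑ k : Fin (N + 1), (G.blocks N k i)ᵀ * (G.Gcov k)⁻¹ * G.blocks N k j) := by
  obtain ⟨hG, hE⟩ := h.noise_covariance hx hN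
  set D := Matrix.comp _ _ _ _ ℝ (Matrix.diagonal fun k : Fin (N + 1) => (G.Gcov k)⁻¹) with hD
  have hED : G.toMatrix N * (covMatrix N μ x * (G.toMatrix N)ᵀ * D) = 1 := by
    rw [← Matrix.mul_assoc, ← Matrix.mul_assoc, hE, hD, ← compRingEquiv_apply,
      ← compRingEquiv_apply, ← map_mul, diagonal_mul_diagonal, ← map_one (compRingEquiv _ _ ℝ),
      ← diagonal_one]
    congr 2
    funext k
    exact mul_nonsing_inv _ (hG k (Nat.le_of_lt_succ k.2)).det_pos.ne'.isUnit
  -- A one-sided inverse of a square matrix is two-sided, so the factor T can be moved to the far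
  -- right, which exhibits a right inverse of C.
  rw [mul_eq_one_comm, Matrix.mul_assoc, Matrix.mul_assoc] at hED
  rw [inv_eq_right_inv hED]
  have hT : (G.toMatrix N)ᵀ = Matrix.comp _ _ _ _ ℝ (Matrix.of fun i k => (G.blocks N k i)ᵀ) := rfl
  rw [hT, hD, toMatrix, ← compRingEquiv_apply, ← compRingEquiv_apply, ← compRingEquiv_apply,
    ← map_mul, ← map_mul, compRingEquiv_apply]
  congr 1
  ext1 i j
  rw [mul_apply, of_apply]
  exact Finset.sum_congr rfl fun k _ => by rw [diagonal_mul, of_apply, Matrix.mul_assoc]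

/-- A sequence with a `CM_L` model is reciprocal iff the parameters obey the backward recursion
`G_k⁻¹ G_{k,N} = G_{k+1,k}' G_{k+1}⁻¹ G_{k+1,N}`, `k ∈ [1,N-2]`. -/
theorem IsModelOf.isReciprocal_iff (hx : IsZMNG N μ x) (hN : 1 ≤ N) (h : G.IsModelOf N μ x) :
    IsReciprocal N μ x ↔ ∀ k, 1 ≤ k → k + 1 < N →
      (G.Gcov k)⁻¹ * G.Gend k = (G.Gprev (k + 1))ᵀ * ((G.Gcov (k + 1))⁻¹ * G.Gend (k + 1)) := by
  -- For 1 ≤ i < N, block column i of T lives in rows i and i + 1 only. Off the three diagonals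
  -- these rows can meet column j only through `Gend`, that is for j = N. When i + 1 = N, row i + 1
  -- drops out and j = N is excluded.
  have key : ∀ i j : Fin (N + 1), 1 ≤ (i : ℕ) → (i : ℕ) < N → (j : ℕ) ≠ i → (j : ℕ) + 1 ≠ i →
      (j : ℕ) ≠ i + 1 →
      ∑ k : Fin (N + 1), (G.blocks N k i)ᵀ * (G.Gcov k)⁻¹ * G.blocks N k j
      = if (j : ℕ) = N then (G.Gprev (i + 1))ᵀ * ((G.Gcov (i + 1))⁻¹ * G.Gend (i + 1))
          - (G.Gcov i)⁻¹ * G.Gend i else 0 := by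
    intro i j h1 h2 hj1 hj2 hj3
    have hii : G.blocks N i i = 1 := by
      simp only [blocks, of_apply]
      rw [if_pos trivial, if_neg (by omega), if_neg (by omega), sub_zero, sub_zero]
    have hij : G.blocks N i j = if (j : ℕ) = N then - G.Gend i else 0 := by
      simp only [blocks, of_apply]
      rw [if_neg hj1, if_neg (by omega)]
      by_cases hj : (j : ℕ) = N
      · rw [if_pos ⟨h2, hj⟩, if_pos hj, sub_zero, zero_sub]
      · rw [if_neg (by omega), if_neg hj, sub_zero, sub_zero]
    set i' : Fin (N + 1) := ⟨i + 1, by omega⟩ with hi'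
    have hne : i ≠ i' := fun hh => by simpa [hi'] using congrArg Fin.val hh
    have hz : ∀ k, k ≠ i ∧ k ≠ i' → (G.blocks N k i)ᵀ * (G.Gcov k)⁻¹ * G.blocks N k j = 0 := by
      intro k hk
      have hk1 : (k : ℕ) ≠ i := fun hh => hk.1 (Fin.ext hh)
      have hk2 : (k : ℕ) ≠ i + 1 := fun hh => hk.2 (Fin.ext hh)
      have : G.blocks N k i = 0 := by
        simp only [blocks, of_apply]
        rw [if_neg (by omega), if_neg (by omega), if_neg (by omega), sub_zero, sub_zero]
      rw [this, transpose_zero, Matrix.zero_mul, Matrix.zero_mul]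
    rw [Fintype.sum_eq_add i i' hne hz, hii, hij, transpose_one, Matrix.one_mul]
    rcases Nat.lt_or_ge ((i : ℕ) + 1) N with hlt | hge
    · have e1 : G.blocks N i' i = - G.Gprev (i + 1) := by
        simp only [blocks, of_apply, hi']
        rw [if_neg (by omega), if_pos (by omega), if_neg (by omega), sub_zero, zero_sub]
      have e2 : G.blocks N i' j = if (j : ℕ) = N then - G.Gend (i + 1) else 0 := by
        simp only [blocks, of_apply, hi']
        rw [if_neg (by omega), if_neg (by omega)]
        by_cases hj : (j : ℕ) = N
        · rw [if_pos ⟨hlt, hj⟩, if_pos hj, sub_zero, zero_sub]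
        · rw [if_neg (by omega), if_neg hj, sub_zero, sub_zero]
      rw [e1, e2]
      split_ifs with hj
      · simp only [hi', transpose_neg, Matrix.neg_mul, Matrix.mul_neg, Matrix.mul_assoc, neg_neg]
        abel
      · simp
    · have hj : (j : ℕ) ≠ N := by omega
      have e1 : G.blocks N i' i = 0 := by
        simp only [blocks, of_apply, hi']
        rw [if_neg (by omega), if_neg (by omega), if_neg (by omega), sub_zero, sub_zero]
      simp [hj, e1]
  rw [hx.isReciprocal_iff, h.inv_covMatrix hx hN]
  constructor
  · intro hP k hk1 hk2
    have hb := key ⟨k, by omega⟩ ⟨N, by omega⟩ hk1 (by simp only; omega) (by simp only; omega)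
      (by simp only; omega) (by simp only; omega)
    rw [if_pos rfl] at hb
    refine (sub_eq_zero.1 (hb.symm.trans ?_)).symm
    ext a b
    exact hP (⟨k, by omega⟩, a) (⟨N, by omega⟩, b) hk1 (by simp only; omega) (by simp only; omega)
      (by simp only; omega) (by simp only; omega)
  · rintro hB ⟨i, a⟩ ⟨j, b⟩ h1 h2 hj1 hj2 hj3
    have hb := key i j h1 h2 hj1 hj2 hj3
    simp only [comp_apply, of_apply]
    rw [hb]
    split_ifs with hj
    · simp only at h1 h2 hj3
      rw [← hB i h1 (by omega), sub_self]
      rfl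
    · rfl

end CMLParams

end Model

/-! ### Noncommutative matrix-inversion identities -/

section RingIdentities

variable {R : Type*} [Ring R] {g g' b bt r r' q q' m m' t tt c c' a : R}

/-- Here and in the next two identities r, q are `infoMatrix` at k and k + 1, b is `endGain (k + 1)`
with transpose bt, g is `Gcov (k + 1)`, and primes are inverses. This one is the step from C_{N|k+1}
to C_{N|k}; conjugated by q it becomes q + bt m b = q r' q, with m = g + g b r' bt g. -/
theorem inv_add_sandwich_eq (hr : r' * r = 1) (hr' : r * r' = 1) (hq : q' * q = 1)
    (hq' : q * q' = 1) (h : q = r + bt * g * b) :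
    q' + (q' * bt) * (g + g * b * r' * bt * g) * (b * q') = r' := by
  have e : q + bt * (g + g * b * r' * bt * g) * b = q * r' * q := by
    have : q * r' * q = r * r' * r + (bt * g * b) * (r' * r) + (r * r') * (bt * g * b)
        + bt * g * b * r' * bt * g * b := by rw [h]; noncomm_ring
    rw [this, hr, hr', h]
    noncomm_ring
  calc q' + (q' * bt) * (g + g * b * r' * bt * g) * (b * q')
      = q' * q * q' + q' * (bt * (g + g * b * r' * bt * g) * b) * q' := by
        rw [hq]; noncomm_ring
    _ = q' * (q + bt * (g + g * b * r' * bt * g) * b) * q' := by noncomm_ring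
    _ = (q' * q) * r' * (q * q') := by rw [e]; noncomm_ring
    _ = r' := by rw [hq, hq', one_mul, mul_one]

/-- Multiplied on the right by G_{k+1,k}, this gives M_{N|k} from M_{N|k+1}. -/
theorem inv_mul_sandwich_eq (hr' : r * r' = 1) (hq : q' * q = 1)
    (hg' : g * g' = 1) (h : q = r + bt * g * b) :
    (q' * bt) * ((g + g * b * r' * bt * g) * g') = r' * bt := by
  calc (q' * bt) * ((g + g * b * r' * bt * g) * g')
      = q' * (bt * (g * g') + bt * g * b * r' * bt * (g * g')) := by noncomm_ring
    _ = q' * ((r * r') * bt + bt * g * b * r' * bt) := by rw [hg', hr']; noncomm_ring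
    _ = (q' * q) * (r' * bt) := by rw [h]; noncomm_ring
    _ = r' * bt := by rw [hq, one_mul]

/-- The Woodbury formula for the noise covariance of the Markov model in `toMarkov`. -/
theorem sandwich_mul_inv (hr' : r' * r = 1) (hq' : q * q' = 1)
    (hg' : g * g' = 1) (h : q = r + bt * g * b) :
    (g + g * b * r' * bt * g) * (g' - b * q' * bt) = 1 := by
  have e : r' * bt * g * b * q' = r' - q' := by
    calc r' * bt * g * b * q' = r' * (q - r) * q' := by rw [h]; noncomm_ring
      _ = r' * (q * q') - (r' * r) * q' := by noncomm_ring
      _ = r' - q' := by rw [hr', hq']; noncomm_ring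
  calc (g + g * b * r' * bt * g) * (g' - b * q' * bt)
      = g * g' + g * b * r' * bt * (g * g') - g * b * q' * bt
          - g * b * (r' * bt * g * b * q') * bt := by noncomm_ring
    _ = 1 := by rw [e, hg']; noncomm_ring

/-- Here t, tt are M_{N|k+1} and its transpose, c is C_{N|k+1}, and m, g are M_{k+1}, G_{k+1}. The
product telescopes: the first factor is m' g, and tt c' times the last one is g' m tt. -/
theorem induced_push_through (hm : m' * m = 1) (hg : g' * g = 1) (hg' : g * g' = 1) (hc : c' * c = 1) (h : g' = m' + tt * c' * t) :
    (1 - tt * c' * t * g) * tt * c' * (c + t * m * tt) = tt := by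
  have e1 : 1 - tt * c' * t * g = m' * g := by
    calc 1 - tt * c' * t * g = g' * g - (g' - m') * g := by rw [hg, h]; noncomm_ring
      _ = m' * g := by noncomm_ring
  have e2 : tt * c' * (c + t * m * tt) = g' * m * tt := by
    calc tt * c' * (c + t * m * tt) = tt * (c' * c) + tt * c' * t * m * tt := by noncomm_ring
      _ = (m' * m) * tt + tt * c' * t * m * tt := by rw [hc, hm]; noncomm_ring
      _ = g' * m * tt := by rw [h]; noncomm_ring
  calc (1 - tt * c' * t * g) * tt * c' * (c + t * m * tt)
      = (1 - tt * c' * t * g) * (tt * c' * (c + t * m * tt)) := by noncomm_ring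
    _ = m' * (g * g') * m * tt := by rw [e1, e2]; noncomm_ring
    _ = tt := by rw [hg', mul_one, hm, one_mul]

end RingIdentities

/-! ### Markov-induced models and the backward recursion -/

section Markov

variable {N d : ℕ}

theorem _root_.Matrix.PosDef.transpose_eq_self {n : Type*} {A : Matrix n n ℝ} (h : A.PosDef) :
    Aᵀ = A := by
  have := h.isHermitian
  rwa [IsHermitian, conjTranspose_eq_transpose_of_trivial] at this

theorem _root_.Matrix.PosDef.mul_inv_self {n : Type*} [Fintype n] [DecidableEq n]
    {A : Matrix n n ℝ} (h : A.PosDef) : A * A⁻¹ = 1 :=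
  mul_nonsing_inv _ h.det_pos.ne'.isUnit

theorem _root_.Matrix.PosDef.inv_mul_self {n : Type*} [Fintype n] [DecidableEq n]
    {A : Matrix n n ℝ} (h : A.PosDef) : A⁻¹ * A = 1 :=
  nonsing_inv_mul _ h.det_pos.ne'.isUnit

theorem _root_.Matrix.PosDef.add_mul_mul_transpose {n : Type*} [Fintype n]
    {A B : Matrix n n ℝ} (hA : A.PosDef) (hB : B.PosDef) (T : Matrix n n ℝ) :
    (A + T * B * Tᵀ).PosDef := by
  have := hB.posSemidef.mul_mul_conjTranspose_same T
  rw [conjTranspose_eq_transpose_of_trivial] at this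
  exact hA.add_posSemidef this

namespace MarkovParams

variable (M : MarkovParams N d)

theorem trans_self : M.trans N = 1 := by
  rw [trans, Nat.sub_self]
  rfl

theorem transFrom_succ (k m : ℕ) :
    M.transFrom k (m + 1) = M.transFrom (k + 1) m * M.Mprev (k + 1) := by
  induction m with
  | zero => simp [transFrom]
  | succ m ih =>
    rw [transFrom, ih, ← Matrix.mul_assoc]
    congr 1
    rw [transFrom]
    congr 2
    omega

theorem trans_eq_mul {k : ℕ} (hk : k < N) : M.trans k = M.trans (k + 1) * M.Mprev (k + 1) := by
  rw [trans, trans, ← transFrom_succ]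
  congr 1
  omega

theorem condCov_eq_add {k : ℕ} (hk : k < N) :
    M.condCov k
      = M.condCov (k + 1) + M.trans (k + 1) * M.Mcov (k + 1) * (M.trans (k + 1))ᵀ := by
  rw [condCov, Finset.sum_eq_sum_Ico_succ_bot hk, add_comm]
  rfl

theorem condCov_self : M.condCov N = 0 := by
  simp [condCov]

theorem condCov_pred (hN : 1 ≤ N) : M.condCov (N - 1) = M.Mcov N := by
  rw [condCov_eq_add _ (by omega), Nat.sub_add_cancel hN, condCov_self, trans_self]
  simp

/-- The downward induction starts at N - 1, where the value is M_N; at N the sum is empty. -/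
theorem condCov_posDef {k : ℕ} (hN : 1 ≤ N) (hk : k ≤ N - 1) : (M.condCov k).PosDef := by
  induction hk using Nat.decreasingInduction with
  | self =>
    rw [condCov_pred _ hN]
    exact M.posDef _ hN le_rfl
  | of_succ k hk ih =>
    rw [condCov_eq_add _ (by omega)]
    exact ih.add_mul_mul_transpose (M.posDef _ (by omega) (by omega)) _

end MarkovParams

namespace CMLParams

variable {G : CMLParams d}

/-- Transposing the formula for G_{k+1,k} leaves M_{k+1,k}' times the left factor of
`induced_push_through`, whose last factor is C_{N|k}; cancelling it gives M_{N|k}' C_{N|k}⁻¹. -/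
theorem IsInducedBy.recursion (hG : ∀ k ≤ N, (G.Gcov k).PosDef) {M : MarkovParams N d}
    (h : G.IsInducedBy M) {k : ℕ} (h1 : 1 ≤ k) (h2 : k + 1 < N) :
    (G.Gcov k)⁻¹ * G.Gend k
      = (G.Gprev (k + 1))ᵀ * ((G.Gcov (k + 1))⁻¹ * G.Gend (k + 1)) := by
  obtain ⟨-, hk, -⟩ := h k h1 (by omega)
  obtain ⟨hp, he, hc⟩ := h (k + 1) (by omega) h2
  have hB : ∀ j ≤ N, ∀ A, (G.Gcov j)⁻¹ * (G.Gcov j * A) = A := fun j hj A => by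
    rw [← Matrix.mul_assoc, (hG j hj).inv_mul_self, Matrix.one_mul]
  have hg := hG (k + 1) h2.le
  have hm := M.posDef (k + 1) (by omega) h2.le
  have hC := M.condCov_posDef (k := k + 1) (by omega) (by omega)
  have hC0 := M.condCov_posDef (k := k) (by omega) (by omega)
  have hginv : (G.Gcov (k + 1))⁻¹ = (M.Mcov (k + 1))⁻¹
      + (M.trans (k + 1))ᵀ * (M.condCov (k + 1))⁻¹ * M.trans (k + 1) := by
    have hpd := hm.inv.add_mul_mul_transpose hC.inv (M.trans (k + 1))ᵀ
    rw [transpose_transpose] at hpd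
    rw [hc, nonsing_inv_nonsing_inv _ hpd.det_pos.ne'.isUnit]
  have key := induced_push_through hm.inv_mul_self hg.inv_mul_self hg.mul_inv_self hC.inv_mul_self
    hginv
  rw [← M.condCov_eq_add (by omega)] at key
  have key' := congrArg (· * (M.condCov k)⁻¹) key
  simp only [Matrix.mul_assoc, hC0.mul_inv_self, Matrix.mul_one] at key'
  rw [hp, hk, he, Matrix.mul_assoc, Matrix.mul_assoc (G.Gcov (k + 1)), hB _ (by omega),
    hB _ h2.le, M.trans_eq_mul (show k < N by omega), transpose_mul, Matrix.mul_assoc, ← key']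
  simp only [transpose_sub, transpose_mul, transpose_transpose, hg.transpose_eq_self,
    hC.inv.transpose_eq_self]
  noncomm_ring

/-- The matrices `G_k⁻¹ G_{k,N}`. -/
def endGain (G : CMLParams d) (k : ℕ) : Matrix (Fin d) (Fin d) ℝ := (G.Gcov k)⁻¹ * G.Gend k

/-- The inverses of the matrices `C_{N|k}` of the Markov model `G.toMarkov`. -/
def infoMatrix (G : CMLParams d) : ℕ → Matrix (Fin d) (Fin d) ℝ
  -- Any positive definite initial value would do: the inducing Markov model is not unique.
  | 0 => 1
  | k + 1 => infoMatrix G k + (G.endGain (k + 1))ᵀ * G.Gcov (k + 1) * G.endGain (k + 1)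

theorem infoMatrix_posDef (hG : ∀ k ≤ N, (G.Gcov k).PosDef) {k : ℕ} (hk : k ≤ N) :
    (G.infoMatrix k).PosDef := by
  induction k with
  | zero => exact PosDef.one
  | succ k ih =>
    have := (ih (by omega)).add_mul_mul_transpose (hG (k + 1) hk) (G.endGain (k + 1))ᵀ
    rwa [transpose_transpose] at this

/-- A Markov model that induces the given `CM_L` model. -/
def toMarkov (hG : ∀ k ≤ N, (G.Gcov k).PosDef) : MarkovParams N d where
  -- At k = N the values are forced by C_{N|N-1} = M_N and M_{N|N-1} = M_{N,N-1}. For k < N, M_k⁻¹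
  -- must be G_k⁻¹ - B_k Q_k⁻¹ B_k', inverted by Woodbury, and then G_{k,k-1} = G_k M_k⁻¹ M_{k,k-1}
  -- is solved for M_{k,k-1}.
  Mcov k := if k = N then (G.infoMatrix (N - 1))⁻¹ else
    G.Gcov k + G.Gcov k * G.endGain k * (G.infoMatrix (k - 1))⁻¹ * (G.endGain k)ᵀ * G.Gcov k
  Mprev k := if k = N then (G.infoMatrix (N - 1))⁻¹ * (G.endGain (N - 1))ᵀ else
    (G.Gcov k + G.Gcov k * G.endGain k * (G.infoMatrix (k - 1))⁻¹ * (G.endGain k)ᵀ * G.Gcov k)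
      * (G.Gcov k)⁻¹ * G.Gprev k
  posDef k h1 h2 := by
    split_ifs with h
    · exact (infoMatrix_posDef hG (by omega)).inv
    · have := (hG k h2).add_mul_mul_transpose
        (infoMatrix_posDef hG (show k - 1 ≤ N by omega)).inv (G.Gcov k * G.endGain k)
      rwa [transpose_mul, (hG k h2).transpose_eq_self, ← Matrix.mul_assoc] at this

/-- Downward induction from N - 1. The covariance step is pure algebra; the recursion `hB` enters
only in the transition step, to recognise G_{k+1,k}' B_{k+1} as B_k. -/
theorem toMarkov_trans (hG : ∀ k ≤ N, (G.Gcov k).PosDef)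
    (hB : ∀ k, 1 ≤ k → k + 1 < N → G.endGain k = (G.Gprev (k + 1))ᵀ * G.endGain (k + 1))
    {k : ℕ} (h1 : 1 ≤ k) (h2 : k ≤ N - 1) :
    (toMarkov hG).condCov k = (G.infoMatrix k)⁻¹ ∧
      (toMarkov hG).trans k = (G.infoMatrix k)⁻¹ * (G.endGain k)ᵀ := by
  induction h2 using Nat.decreasingInduction with
  | self =>
    refine ⟨?_, ?_⟩
    · rw [MarkovParams.condCov_pred _ (by omega)]
      exact if_pos rfl
    · rw [MarkovParams.trans_eq_mul _ (by omega), Nat.sub_add_cancel (by omega),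
        MarkovParams.trans_self, Matrix.one_mul]
      exact if_pos rfl
  | of_succ k hk ih =>
    obtain ⟨hc, ht⟩ := ih (by omega)
    have hg := hG (k + 1) (by omega)
    have hr := infoMatrix_posDef hG (show k ≤ N by omega)
    have hq := infoMatrix_posDef hG (show k + 1 ≤ N by omega)
    have hne : k + 1 ≠ N := by omega
    rw [MarkovParams.condCov_eq_add _ (by omega),
      MarkovParams.trans_eq_mul _ (show k < N by omega), hc, ht]
    constructor
    · rw [transpose_mul, transpose_transpose, hq.inv.transpose_eq_self]
      simp only [toMarkov, if_neg hne]
      exact inv_add_sandwich_eq hr.inv_mul_self hr.mul_inv_self hq.inv_mul_self hq.mul_inv_self rfl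
    · simp only [toMarkov, if_neg hne]
      rw [← Matrix.mul_assoc]
      refine (congrArg (· * G.Gprev (k + 1)) (inv_mul_sandwich_eq hr.mul_inv_self hq.inv_mul_self
        hg.mul_inv_self rfl)).trans ?_
      rw [hB k h1 (by omega), transpose_mul, transpose_transpose, ← Matrix.mul_assoc]

theorem isInducedBy_toMarkov (hG : ∀ k ≤ N, (G.Gcov k).PosDef)
    (hB : ∀ k, 1 ≤ k → k + 1 < N → G.endGain k = (G.Gprev (k + 1))ᵀ * G.endGain (k + 1)) :
    G.IsInducedBy (toMarkov hG) := by
  intro k h1 h2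
  obtain ⟨hc, ht⟩ := toMarkov_trans hG hB h1 (by omega)
  have hg := hG k h2.le
  have hr := infoMatrix_posDef hG (show k - 1 ≤ N by omega)
  have hq := infoMatrix_posDef hG h2.le
  have hqr : G.infoMatrix k
      = G.infoMatrix (k - 1) + (G.endGain k)ᵀ * G.Gcov k * G.endGain k := by
    obtain ⟨j, rfl⟩ : ∃ j, k = j + 1 := ⟨k - 1, by omega⟩
    rfl
  have hend : G.Gcov k * G.endGain k = G.Gend k := by
    rw [endGain, ← Matrix.mul_assoc, hg.mul_inv_self, Matrix.one_mul]
  have hinv : (toMarkov hG).Mcov k * ((G.Gcov k)⁻¹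
      - G.endGain k * (G.infoMatrix k)⁻¹ * (G.endGain k)ᵀ) = 1 := by
    simp only [toMarkov, if_neg h2.ne]
    exact sandwich_mul_inv hr.inv_mul_self hq.mul_inv_self hg.mul_inv_self hqr
  rw [hc, ht, transpose_mul, transpose_transpose, hq.inv.transpose_eq_self,
    nonsing_inv_nonsing_inv _ hq.det_pos.ne'.isUnit]
  refine ⟨?_, ?_, ?_⟩
  · have hprev : (toMarkov hG).Mprev k = (toMarkov hG).Mcov k * (G.Gcov k)⁻¹ * G.Gprev k := by
      simp only [toMarkov, if_neg h2.ne]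
    have hinv' := mul_eq_one_comm.1 hinv
    rw [hprev, ← hend]
    symm
    calc _ = (G.Gcov k * (G.Gcov k)⁻¹) * (toMarkov hG).Mcov k * (G.Gcov k)⁻¹ * G.Gprev k
          - G.Gcov k * G.endGain k * ((G.infoMatrix k)⁻¹ * (G.endGain k)ᵀ)
            * ((toMarkov hG).Mcov k * (G.Gcov k)⁻¹ * G.Gprev k) := by
          rw [hg.mul_inv_self, Matrix.one_mul]
      _ = G.Gcov k * (((G.Gcov k)⁻¹ - G.endGain k * (G.infoMatrix k)⁻¹ * (G.endGain k)ᵀ)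
            * (toMarkov hG).Mcov k) * (G.Gcov k)⁻¹ * G.Gprev k := by noncomm_ring
      _ = G.Gprev k := by
          rw [hinv', Matrix.mul_one, hg.mul_inv_self, Matrix.one_mul]
  · rw [Matrix.mul_assoc, Matrix.mul_assoc, hq.inv_mul_self, Matrix.mul_one, hend]
  · rw [inv_eq_right_inv hinv]
    have : (G.Gcov k)⁻¹ - G.endGain k * (G.infoMatrix k)⁻¹ * (G.endGain k)ᵀ
        + G.endGain k * (G.infoMatrix k)⁻¹ * G.infoMatrix k
          * ((G.infoMatrix k)⁻¹ * (G.endGain k)ᵀ) = (G.Gcov k)⁻¹ := by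
      rw [Matrix.mul_assoc (G.endGain k) _ (G.infoMatrix k), hq.inv_mul_self, Matrix.mul_one,
        ← Matrix.mul_assoc, sub_add_cancel]
    rw [this, nonsing_inv_nonsing_inv _ hg.det_pos.ne'.isUnit]

/-- A `CM_L` model is induced by a Markov model iff its parameters obey the backward recursion
`G_k⁻¹ G_{k,N} = G_{k+1,k}' G_{k+1}⁻¹ G_{k+1,N}`, `k ∈ [1,N-2]`. -/
theorem exists_isInducedBy_iff (hG : ∀ k ≤ N, (G.Gcov k).PosDef) :
    (∃ M : MarkovParams N d, G.IsInducedBy M) ↔ ∀ k, 1 ≤ k → k + 1 < N →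
      (G.Gcov k)⁻¹ * G.Gend k = (G.Gprev (k + 1))ᵀ * ((G.Gcov (k + 1))⁻¹ * G.Gend (k + 1)) :=
  ⟨fun ⟨_, hM⟩ _ h1 h2 => hM.recursion hG h1 h2, fun h => ⟨_, isInducedBy_toMarkov hG h⟩⟩

end CMLParams

end Markov

namespace CMLParams

/-! ### Existence of a `CM_L` model for a reciprocal sequence -/

section Existence

variable {Ω : Type*} {d N : ℕ}

/-- Zero noise forces the zero sequence: the final state vanishes first, then x_0, then the others
forward in time. -/
theorem isUnit_toMatrix (G : CMLParams d) : IsUnit (G.toMatrix N) := by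
  rw [← mulVec_injective_iff_isUnit, ← coe_mulVecLin, ← LinearMap.ker_eq_bot,
    LinearMap.ker_eq_bot']
  intro v hv
  rw [mulVecLin_apply] at hv
  -- A deterministic vector is viewed as a sequence on a one-point space, so that `coord_noise`
  -- applies.
  set y : ℕ → Unit → (Fin d → ℝ) := fun k _ a =>
    if h : k ≤ N then v (⟨k, Nat.lt_succ_of_le h⟩, a) else 0 with hy
  have hyv : ∀ p : Fin (N + 1) × Fin d, y p.1 () p.2 = v p := fun p => by
    simp only [hy]
    rw [dif_pos (Nat.le_of_lt_succ p.1.2)]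
  have hnoise : ∀ k ≤ N, G.noise N y k () = 0 := by
    intro k hk
    funext a
    have h1 := congrFun (congrFun (G.coord_noise N y) (⟨k, Nat.lt_succ_of_le hk⟩, a)) ()
    have h2 := congrFun hv (⟨k, Nat.lt_succ_of_le hk⟩, a)
    refine (h1.trans ?_).trans h2
    exact Finset.sum_congr rfl fun p _ => by rw [coord, hyv]
  have hN : y N () = 0 := by
    simpa [noise] using hnoise N le_rfl
  have hk : ∀ k ≤ N, y k () = 0 := by
    intro k
    induction k with
    | zero =>
      intro h0
      have := hnoise 0 h0
      simpa [noise, hN] using this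
    | succ k ih =>
      intro hk
      have := hnoise (k + 1) hk
      simpa [noise, hN, ih (by omega)] using this
  funext p
  rw [← hyv, hk _ (Nat.le_of_lt_succ p.1.2)]
  rfl

theorem toMatrix_eq_zero (G : CMLParams d) {p q : Fin (N + 1) × Fin d}
    (h1 : (q.1 : ℕ) ≠ p.1) (h2 : (q.1 : ℕ) + 1 = p.1 → (p.1 : ℕ) = N) (h3 : (q.1 : ℕ) ≠ N) :
    G.toMatrix N p q = 0 := by
  have : G.blocks N p.1 q.1 = 0 := by
    simp only [blocks, of_apply]
    rw [if_neg h1, if_neg (by omega), if_neg (by omega), sub_zero, sub_zero]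
  exact congrFun (congrFun this p.2) q.2

/-- The `CM_L` parameters whose gains are read off from coefficients `c p` for each coordinate. -/
def ofCoeffs (c : Fin (N + 1) × Fin d → Fin (N + 1) × Fin d → ℝ)
    (D : ℕ → Matrix (Fin d) (Fin d) ℝ) : CMLParams d where
  Gprev k := Matrix.of fun a b => if h : k < N + 1 then
    c (⟨k, h⟩, a) (⟨k - 1, (Nat.sub_le k 1).trans_lt h⟩, b) else 0
  Gend k := Matrix.of fun a b => if h : k < N + 1 then c (⟨k, h⟩, a) (⟨N, N.lt_succ_self⟩, b) else 0
  Gcov := D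

theorem toMatrix_ofCoeffs {c : Fin (N + 1) × Fin d → Fin (N + 1) × Fin d → ℝ}
    (D : ℕ → Matrix (Fin d) (Fin d) ℝ) {p : Fin (N + 1) × Fin d} (hp : (p.1 : ℕ) < N)
    (hc : ∀ q, (q.1 : ℕ) + 1 ≠ p.1 → (q.1 : ℕ) ≠ N → c p q = 0) :
    (ofCoeffs c D).toMatrix N p = Pi.single p 1 - c p := by
  obtain ⟨k, a⟩ := p
  simp only at hp hc
  funext ⟨j, b⟩
  have hk := k.2
  change (ofCoeffs c D).blocks N k j a b = _
  simp only [blocks, of_apply, Pi.sub_apply, Matrix.sub_apply]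
  by_cases h1 : (j : ℕ) + 1 = k
  · rw [if_neg (by omega), if_pos (by omega), if_neg (by omega), Pi.single_eq_of_ne]
    · have : j = ⟨(k : ℕ) - 1, (Nat.sub_le (k : ℕ) 1).trans_lt hk⟩ := Fin.ext (by simp only; omega)
      simp only [ofCoeffs, of_apply, dif_pos hk, Matrix.zero_apply, sub_zero, zero_sub]
      rw [← this]
    · rintro ⟨⟩
      omega
  · by_cases h2 : (j : ℕ) = N
    · rw [if_neg (by omega), if_neg (by omega), if_pos ⟨hp, h2⟩, Pi.single_eq_of_ne]
      · have : j = ⟨N, N.lt_succ_self⟩ := Fin.ext h2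
        simp only [ofCoeffs, of_apply, dif_pos hk, Matrix.zero_apply, sub_zero, zero_sub]
        rw [← this]
      · rintro ⟨⟩
        omega
    · rw [if_neg (by omega : ¬ (1 ≤ (k : ℕ) ∧ (k : ℕ) < N ∧ (j : ℕ) = k - 1)),
        if_neg (by omega : ¬ ((k : ℕ) < N ∧ (j : ℕ) = N)), hc (j, b) h1 h2]
      by_cases h3 : j = k
      · subst h3
        by_cases hab : b = a
        · subst hab
          simp
        · rw [Pi.single_eq_of_ne (fun h => hab (Prod.ext_iff.1 h).2), if_pos rfl,
            one_apply_ne (Ne.symm hab)]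
          simp
      · rw [if_neg (fun h => h3 (Fin.ext h)),
          Pi.single_eq_of_ne (fun h => h3 (Prod.ext_iff.1 h).1)]
        simp

variable [MeasurableSpace Ω] {μ : Measure Ω} [IsProbabilityMeasure μ] {x : ℕ → Ω → (Fin d → ℝ)}

/-- If the noise of a `CM_L` model is uncorrelated with the past and with the final state, then it
is white, so that the model is a model of the sequence. -/
theorem isModelOf_of_uncorrelated (hx : IsZMNG N μ x) (hN : 1 ≤ N) (G : CMLParams d)
    (hG : ∀ k, G.Gcov k = crossCov μ (G.noise N x k) (G.noise N x k))
    (h : ∀ p q : Fin (N + 1) × Fin d, (p.1 : ℕ) < N → (q.1 : ℕ) < p.1 ∨ (q.1 : ℕ) = N →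
      (covMatrix N μ x *ᵥ G.toMatrix N p) q = 0) : G.IsModelOf N μ x := by
  have hx' := hx.isCentredGaussian
  have hcoord := G.coord_noise N x
  -- The noise at q involves only states at times before p or at N, all uncorrelated with the noise
  -- at p.
  have half : ∀ p q : Fin (N + 1) × Fin d, (p.1 : ℕ) < N →
      (q.1 : ℕ) < p.1 ∨ (q.1 : ℕ) = N →
      cov[lin (coord N x) (G.toMatrix N q), lin (coord N x) (G.toMatrix N p); μ] = 0 := by
    intro p q hp hq
    rw [hx'.covariance_lin]
    refine Finset.sum_eq_zero fun r _ => ?_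
    by_cases hr : (r.1 : ℕ) < p.1 ∨ (r.1 : ℕ) = N
    · rw [famCov_coord, h p r hp hr, mul_zero]
    · rw [G.toMatrix_eq_zero (by omega) (by omega) (by omega), zero_mul]
  have hpd : (covMatrix N μ (G.noise N x)).PosDef := by
    rw [← famCov_coord, hcoord, hx'.famCov_lin, famCov_coord,
      ← conjTranspose_eq_transpose_of_trivial]
    exact hx.nonsingular.mul_mul_conjTranspose_same
      (vecMul_injective_iff_isUnit.2 G.isUnit_toMatrix)
  have hgauss : IsCentredGaussian μ (coord N (G.noise N x)) := by
    rw [hcoord]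
    exact hx'.lin_family _
  refine ⟨G.noise N x, ⟨hgauss.isZMNG hpd, fun i hi j hj hij => ?_⟩, fun k _ => (hG k).symm,
    fun k h1 h2 => .of_forall fun ω => ?_, .of_forall fun ω => ?_, .of_forall fun ω => ?_⟩
  · ext a b
    have e : ∀ k (hk : k ≤ N) (a : Fin d), (fun ω => G.noise N x k ω a)
        = lin (coord N x) (G.toMatrix N (⟨k, Nat.lt_succ_of_le hk⟩, a)) := fun k hk a =>
      congrFun hcoord (⟨k, Nat.lt_succ_of_le hk⟩, a)
    rw [crossCov, of_apply, e i hi, e j hj]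
    by_cases hc : j < N ∧ (i < j ∨ i = N)
    · exact half (⟨j, _⟩, b) (⟨i, _⟩, a) hc.1 hc.2
    · rw [covariance_comm]
      exact half (⟨i, _⟩, a) (⟨j, _⟩, b) (show i < N by omega) (show j < i ∨ j = N by omega)
  · rw [noise, if_pos ⟨h1, h2⟩, if_pos h2]
    abel
  · simp [noise]
  · have : 0 < N := hN
    simp [noise, this]

/-- Every reciprocal ZMNG sequence has a `CM_L` model. -/
theorem exists_isModelOf (hx : IsZMNG N μ x) (hr : IsReciprocal N μ x) :
    ∃ G : CMLParams d, G.IsModelOf N μ x := by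
  rcases Nat.eq_zero_or_pos N with rfl | hN
  · refine ⟨⟨0, 0, fun k => crossCov μ (x k) (x k)⟩, x, ⟨hx, ?_⟩, fun _ _ => rfl, ?_, ?_, ?_⟩
    · intro i hi j hj hij
      omega
    · intro k h1 h2
      omega
    · exact .of_forall fun _ => rfl
    · exact .of_forall fun _ => by simp
  have hx' := hx.isCentredGaussian
  -- The vector c gives the regression of coordinate p on the previous and the final state; at time
  -- 0 only the final state remains.
  have hex : ∀ p : Fin (N + 1) × Fin d, ∃ c : Fin (N + 1) × Fin d → ℝ,
      (∀ q ∉ {q : Fin (N + 1) × Fin d | (q.1 : ℕ) + 1 = p.1 ∨ (q.1 : ℕ) = N}, c q = 0) ∧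
      ∀ q ∈ {q : Fin (N + 1) × Fin d | (q.1 : ℕ) + 1 = p.1 ∨ (q.1 : ℕ) = N},
        (covMatrix N μ x *ᵥ c) q = (covMatrix N μ x *ᵥ Pi.single p 1) q :=
    fun p => exists_supported_mulVec_eq hx.nonsingular _ _
  choose c hc hcov using hex
  set D : ℕ → Matrix (Fin d) (Fin d) ℝ := fun k =>
    crossCov μ ((ofCoeffs c 0).noise N x k) ((ofCoeffs c 0).noise N x k) with hD
  refine ⟨ofCoeffs c D, isModelOf_of_uncorrelated hx hN _ (fun _ => rfl) ?_⟩
  intro p q hp hq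
  have hT := toMatrix_ofCoeffs D hp fun q h1 h2 =>
    hc p q (by simp only [Set.mem_ofPred_eq]; omega)
  have hC : ∀ q : Fin (N + 1) × Fin d, (q.1 : ℕ) + 1 = p.1 ∨ (q.1 : ℕ) = N →
      (covMatrix N μ x *ᵥ (ofCoeffs c D).toMatrix N p) q = 0 := by
    intro q hq
    rw [hT, mulVec_sub, Pi.sub_apply, hcov p q hq, sub_self]
  by_cases hqC : (q.1 : ℕ) + 1 = p.1 ∨ (q.1 : ℕ) = N
  · exact hC q hqC
  -- For earlier q, the window (k-1, N) with k the time of p separates x_k from the past: the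
  -- residual is uncorrelated with the two endpoints, hence with q.
  have hci := hr (p.1 - 1) N (by omega) le_rfl
  rw [sigmaOf_eq_sigmaFam (N := N) x, sigmaOf_eq_sigmaFam (N := N) x,
    sigmaOf_eq_sigmaFam (N := N) x] at hci
  · refine hx'.famCov_mulVec_eq_zero hci ?_ ?_ q ?_
    · intro r hr
      simp only [Set.mem_union, Set.mem_ofPred_eq, Set.mem_insert_iff,
        Set.mem_singleton_iff] at hr
      have := r.1.2
      exact toMatrix_eq_zero _ (by omega) (by omega) (by omega)
    · intro r hr
      simp only [Set.mem_ofPred_eq, Set.mem_insert_iff, Set.mem_singleton_iff] at hr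
      exact hC r (by omega)
    · simp only [Set.mem_ofPred_eq]
      have := q.1.2
      omega
  all_goals intro i
  all_goals simp only [Set.mem_ofPred_eq, Set.mem_insert_iff, Set.mem_singleton_iff]
  all_goals omega

end Existence

/-! ### Combining the two characterizations -/

section Main

variable {Ω : Type*} [MeasurableSpace Ω] {μ : Measure Ω} [IsProbabilityMeasure μ] {N d : ℕ}
  {x : ℕ → Ω → (Fin d → ℝ)} {G : CMLParams d}

theorem IsModelOf.isReciprocal_iff_exists_isInducedBy (hx : IsZMNG N μ x)
    (h : G.IsModelOf N μ x) :
    IsReciprocal N μ x ↔ ∃ M : MarkovParams N d, G.IsInducedBy M := by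
  rcases Nat.eq_zero_or_pos N with rfl | hN
  · exact ⟨fun _ => ⟨⟨0, 0, fun k h1 h2 => by omega⟩, fun k h1 h2 => by omega⟩,
      fun _ j l h1 h2 => by omega⟩
  · rw [h.isReciprocal_iff hx hN, exists_isInducedBy_iff (h.noise_covariance hx hN).1]

end Main

end CMLParams

end CMSeq

end

theorem mainTheorem1 {Ω : Type*} [MeasurableSpace Ω] (μ : Measure Ω) [IsProbabilityMeasure μ]
    (N d : ℕ) (x : ℕ → Ω → (Fin d → ℝ)) (hx : CMSeq.IsZMNG N μ x) :
    (CMSeq.IsReciprocal N μ x ↔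
      ∃ (G : CMSeq.CMLParams d) (M : CMSeq.MarkovParams N d),
        G.IsModelOf N μ x ∧ G.IsInducedBy M) ∧
    (∀ G : CMSeq.CMLParams d, G.IsModelOf N μ x →
      (CMSeq.IsReciprocal N μ x ↔ ∃ M : CMSeq.MarkovParams N d, G.IsInducedBy M)) := by
  refine ⟨⟨fun hr => ?_, ?_⟩, fun G hG => hG.isReciprocal_iff_exists_isInducedBy hx⟩
  · obtain ⟨G, hG⟩ := CMSeq.CMLParams.exists_isModelOf hx hr
    obtain ⟨M, hM⟩ := (hG.isReciprocal_iff_exists_isInducedBy hx).1 hr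
    exact ⟨G, M, hG, hM⟩
  · rintro ⟨G, M, hG, hM⟩
    exact (hG.isReciprocal_iff_exists_isInducedBy hx).2 ⟨M, hM⟩
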